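/- Let $\Gamma$ be a finite group, $K/K_0$ a Galois extension of number fields with a fixed isomorphism $\tau:\mathrm{Gal}(K/K_0)\cong\Gamma$, and $S$ a (possibly infinite) set of primes not dividing $|\Gamma|$. Let $\mathbb Z_S$ be the localization of $\mathbb Z$ at the nonzero integers not divisible by any prime in $S$. Let $e_1=|\Gamma|^{-1}\sum_{\sigma\in\Gamma}\sigma$, and write $(1-e_1)\mathbb Z_S[\Gamma]$ for the ring $\mathbb Z_S[\Gamma]/e_1\mathbb Z_S[\Gamma]$. Let $e_2,\dots,e_m$ be the irreducible central idempotents of $\mathbb Q[\Gamma]$ other than $e_1$; for each $i$ let $\chi_i$ be the character of the irreducible $\mathbb Q$-representation of $\Gamma$ on which $e_i$ acts as the identity, let $\varphi_i$ be any absolutely irreducible character contained in $\chi_i$, and let $h_i>0$ be given by $h_i^2=\dim_{K_i}e_i\mathbb Q[\Gamma]$, where $K_i$ is the center of $e_i\mathbb Q[\Gamma]$. For each infinite place $v$ of $K_0$ let $\Gamma_v\subseteq\Gamma$ be the decomposition group of a chosen place of $K$ above $v$, and let $$\chi_K=-1+\sum_{v\mid\infty}\mathrm{Ind}_{\Gamma_v}^{\Gamma}1,\qquad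 u_i=\tfrac1{h_i}\langle\chi_K,\varphi_i\rangle\quad(2\le i\le m).$$ For a finite $(1-e_1)\mathbb Z_S[\Gamma]$-module $H$ put $|H|^{\underline u}=\prod_{i=2}^m|e_iH|^{u_i}$. 1. For every finite $(1-e_1)\mathbb Z_S[\Gamma]$-module $H$, $$|H|^{\underline u}=\prod_{v\mid\infty}|H^{\Gamma_v}|,$$ where $v$ runs over all infinite places of $K_0$. 2. Call a random isomorphism class $X$ of finite $(1-e_1)\mathbb Z_S[\Gamma]$-modules a Cohen–Martinet random module of rank $\underline u$ if $$\frac{\mathbb P(X\cong G_1)}{\mathbb P(X\cong G_2)}=\frac{|G_2|^{\underline u}\,|\mathrm{Aut}_\Gamma(G_2)|}{|G_1|^{\underline u}\,|\mathrm{Aut}_\Gamma(G_1)|}$$ for all finite $(1-e_1)\mathbb Z_S[\Gamma]$-modules $G_1,G_2$. Then $X$ is such a random module if and only if there is a constant $c>0$ with $$\mathbb P(X\cong H)=\frac{c}{\prod_{v\mid\infty}|H^{\Gamma_v}|\cdot|\mathrm{Aut}_\Gamma(H)|}\quad\text{for all }H.$$ In particular, if $K_0=\mathbb Q$ and $\Gamma_\infty$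 is the decomposition group of any infinite place of $K$, this condition reads $\mathbb P(X\cong H)=c/(|H^{\Gamma_\infty}|\,|\mathrm{Aut}_\Gamma(H)|)$ for all $H$. -/

import Mathlib

open scoped ComplexConjugate

noncomputable section

namespace CohenMartinet

section GroupRing

/-- The nonzero integers that are not divisible by any prime of `S`. -/
def primeToS (S : Set Nat.Primes) : Submonoid ℤ where
  carrier := {n | n ≠ 0 ∧ ∀ p ∈ S, ¬ ((p : ℕ) : ℤ) ∣ n}
  one_mem' := ⟨one_ne_zero, fun p _ h =>
    p.2.one_lt.ne' (Nat.dvd_one.mp (by exact_mod_cast h))⟩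
  mul_mem' := by
    rintro a b ⟨ha, ha'⟩ ⟨hb, hb'⟩
    refine ⟨mul_ne_zero ha hb, fun p hp h => ?_⟩
    rcases (Nat.prime_iff_prime_int.mp p.2).dvd_or_dvd h with h | h
    · exact ha' p hp h
    · exact hb' p hp h

/-- `ℤ_S`, the localization of `ℤ` at the nonzero integers not divisible by any prime of `S`. -/
abbrev ZS (S : Set Nat.Primes) : Type := Localization (primeToS S)

/-- The inclusion `ℤ_S → ℚ`. -/
def ZS.toRat (S : Set Nat.Primes) : ZS S →+* ℚ :=
  IsLocalization.lift (M := primeToS S) (g := Int.castRingHom ℚ) fun y =>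
    isUnit_iff_ne_zero.mpr (by simpa using y.2.1)

variable (Γ : Type*) [Group Γ] [Fintype Γ]

/-- `e₁ = |Γ|⁻¹ ∑ σ` in `R[Γ]`. It is only used when `|Γ|` is a unit of `R`, and then
`Ring.inverse` is the inverse. -/
def e₁ (R : Type*) [CommRing R] : MonoidAlgebra R Γ :=
  Ring.inverse (Fintype.card Γ : R) • ∑ σ : Γ, MonoidAlgebra.single σ 1

theorem e₁_central (R : Type*) [CommRing R] (x : MonoidAlgebra R Γ) :
    e₁ Γ R * x = x * e₁ Γ R := by
  induction x using MonoidAlgebra.induction_on with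
  | of g =>
    simp only [e₁, smul_mul_assoc, mul_smul_comm, Finset.sum_mul, Finset.mul_sum,
      MonoidAlgebra.of_apply, MonoidAlgebra.single_mul_single, mul_one]
    congr 1
    exact (Equiv.sum_comp (Equiv.mulRight g)
        (fun x => (MonoidAlgebra.single x 1 : MonoidAlgebra R Γ))).trans
      (Equiv.sum_comp (Equiv.mulLeft g)
        (fun x => (MonoidAlgebra.single x 1 : MonoidAlgebra R Γ))).symm
  | add a b ha hb => rw [mul_add, add_mul, ha, hb]
  | smul r a ha => rw [mul_smul_comm, smul_mul_assoc, ha]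

instance e₁_isTwoSided (R : Type*) [CommRing R] :
    (Ideal.span {e₁ Γ R} : Ideal (MonoidAlgebra R Γ)).IsTwoSided where
  mul_mem_of_left {a} b ha := by
    obtain ⟨c, rfl⟩ := Ideal.mem_span_singleton'.mp ha
    rw [mul_assoc, e₁_central, ← mul_assoc]
    exact Ideal.mem_span_singleton'.mpr ⟨_, rfl⟩

/-- The ring `(1 - e₁) ℤ_S[Γ]`, as the quotient `ℤ_S[Γ] / e₁ ℤ_S[Γ]`. -/
abbrev ReducedRing (S : Set Nat.Primes) :=
  MonoidAlgebra (ZS S) Γ ⧸ (Ideal.span {e₁ Γ (ZS S)} : Ideal (MonoidAlgebra (ZS S) Γ))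

/-- The projection `ℤ_S[Γ] → (1 - e₁) ℤ_S[Γ]`. -/
def toReduced (S : Set Nat.Primes) : MonoidAlgebra (ZS S) Γ →+* ReducedRing Γ S :=
  Ideal.Quotient.mk _

end GroupRing

section Idempotents

/-- The irreducible (primitive) central idempotents of a ring. -/
structure IsIrredCentralIdem {A : Type*} [Ring A] (e : A) : Prop where
  idem : IsIdempotentElem e
  central : e ∈ Set.center A
  ne_zero : e ≠ 0
  irred : ∀ f : A, IsIdempotentElem f → f ∈ Set.center A → f * e = f → f = 0 ∨ f = e

theorem IsIrredCentralIdem.mul_eq_zero {A : Type*} [Ring A] {e f : A}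
    (he : IsIrredCentralIdem e) (hf : IsIrredCentralIdem f) (h : e ≠ f) : e * f = 0 := by
  have hc : e * f = f * e := (he.central.comm f)
  have h1 : IsIdempotentElem (e * f) := by
    unfold IsIdempotentElem
    rw [mul_assoc, ← mul_assoc f e f, ← hc, mul_assoc e f f, hf.idem.eq, ← mul_assoc, he.idem.eq]
  have h2 : e * f ∈ Set.center A := Set.mul_mem_center he.central hf.central
  rcases he.irred _ h1 h2 (by rw [hc, mul_assoc, he.idem.eq]) with h3 | h3
  · exact h3
  · rcases hf.irred _ h1 h2 (by rw [mul_assoc, hf.idem.eq]) with h4 | h4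
    · exact h4
    · exact absurd (h3.symm.trans h4) h

instance finite_irredCentralIdem {A : Type*} [Ring A] [Algebra ℚ A] [FiniteDimensional ℚ A] :
    Finite {e : A // IsIrredCentralIdem e} := by
  have : LinearIndependent ℚ (Subtype.val : {e : A // IsIrredCentralIdem e} → A) := by
    classical
    rw [linearIndependent_iff']
    intro s g hg i hi
    have h := congrArg (· * i.1) hg
    simp only [Finset.sum_mul, zero_mul, smul_mul_assoc] at h
    rw [Finset.sum_eq_single_of_mem i hi fun j _ hj => by
      rw [j.2.mul_eq_zero i.2 fun h => hj (Subtype.ext h), smul_zero], i.2.idem.eq] at h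
    exact (smul_eq_zero.mp h).resolve_right i.2.ne_zero
  exact this.finite

/-- `h` with `h² = dim_Z (eA)`, where `Z` is the center of the ring `eA = eAe`
(for `e` an irreducible central idempotent of a semisimple algebra this dimension is a square). -/
def hDim {A : Type*} [Ring A] {e : A} (he : IsIrredCentralIdem e) : ℝ :=
  Real.sqrt (Module.finrank (Subring.center he.idem.Corner) he.idem.Corner)

variable (Γ : Type*) [Group Γ] [Fintype Γ]

/-- The irreducible central idempotents `e₂, …, e_m` of `ℚ[Γ]` other than `e₁`. -/
abbrev Idx : Type _ :=
  {e : {e : MonoidAlgebra ℚ Γ // IsIrredCentralIdem e} // e.1 ≠ e₁ Γ ℚ}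

end Idempotents

section Modules

variable {Γ : Type*} [Group Γ] [Fintype Γ] {S : Set Nat.Primes}
  (H : Type*) [AddCommGroup H] [Module (ReducedRing Γ S) H]

/-- `eH` for `e ∈ ℚ[Γ]`: the image of multiplication by `e`, regarded as an element of `ℤ_S[Γ]`.
The inclusion `ℤ_S[Γ] → ℚ[Γ]` is injective, and its image contains each central
idempotent `e` if no prime of `S` divides `|Γ|`; so the supremum has exactly one term. -/
def idemPart (e : MonoidAlgebra ℚ Γ) : AddSubgroup H :=
  ⨆ r : {r : MonoidAlgebra (ZS S) Γ // MonoidAlgebra.mapRingHom Γ (ZS.toRat S) r = e},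
    (DistribSMul.toAddMonoidHom H (toReduced Γ S r.1)).range

/-- `|H|^u = ∏ᵢ |eᵢ H|^{uᵢ}`, the product being over the finite set `Idx Γ`. -/
def weight (u : Idx Γ → ℝ) : ℝ :=
  ∏ᶠ i : Idx Γ, (Nat.card (idemPart (S := S) H i.1.1) : ℝ) ^ u i

/-- The fixed points `H^Δ`. -/
def fixedPart (Δ : Subgroup Γ) : Set H :=
  {x | ∀ γ ∈ Δ, toReduced Γ S (MonoidAlgebra.of (ZS S) Γ γ) • x = x}

end Modules

section Rank

variable {Γ : Type*} [Group Γ] [Fintype Γ]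

/-- `⟨χ, ψ⟩ = |Γ|⁻¹ ∑ χ(g) conj ψ(g)`. -/
def pairing (χ ψ : Γ → ℂ) : ℂ :=
  (Fintype.card Γ : ℂ)⁻¹ * ∑ g : Γ, χ g * conj (ψ g)

open Classical in
/-- The class function on `Γ` induced from a class function on the subgroup `Δ`. -/
def induced (Δ : Subgroup Γ) (f : Δ → ℂ) (g : Γ) : ℂ :=
  (Nat.card Δ : ℂ)⁻¹ * ∑ x : Γ, if h : x⁻¹ * g * x ∈ Δ then f ⟨x⁻¹ * g * x, h⟩ else 0

/-- `χ` is the character of an irreducible `ℚ`-representation on which `e` acts as the identity. -/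
def IsRatCharOf (e : MonoidAlgebra ℚ Γ) (χ : Γ → ℚ) : Prop :=
  ∃ (n : ℕ) (ρ : Representation ℚ Γ (Fin n → ℚ)),
    ρ.IsIrreducible ∧ ρ.asAlgebraHom e = 1 ∧ χ = ρ.character

/-- `φ` is an absolutely irreducible character of `Γ`. -/
def IsAbsIrredChar (φ : Γ → ℂ) : Prop :=
  ∃ (n : ℕ) (ρ : Representation ℂ Γ (Fin n → ℂ)), ρ.IsIrreducible ∧ φ = ρ.character

/-- `φ` is an absolutely irreducible character contained in the irreducible rational character
corresponding to `e`. -/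
def IsAbsIrredCharIn (e : MonoidAlgebra ℚ Γ) (φ : Γ → ℂ) : Prop :=
  IsAbsIrredChar φ ∧ ∃ χ : Γ → ℚ, IsRatCharOf e χ ∧ pairing (fun g => (χ g : ℂ)) φ ≠ 0

variable {K₀ K : Type*} [Field K₀] [NumberField K₀] [Field K] [NumberField K] [Algebra K₀ K]

/-- The decomposition group in `Γ` of an infinite place of `K`, where `τ : Gal(K/K₀) ≃ Γ`. -/
def decomp (τ : Gal(K/K₀) ≃* Γ) (w : NumberField.InfinitePlace K) : Subgroup Γ :=
  (MulAction.stabilizer Gal(K/K₀) w).map τ.toMonoidHom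

/-- `χ_K = -1 + ∑_{v ∣ ∞} Ind_{Γ_v}^Γ 1`, where `Γ_v` is the decomposition group of the place
`w v` of `K` above `v`. -/
def chiK (τ : Gal(K/K₀) ≃* Γ)
    (w : NumberField.InfinitePlace K₀ → NumberField.InfinitePlace K) (g : Γ) : ℂ :=
  -1 + ∑ v : NumberField.InfinitePlace K₀, induced (decomp τ (w v)) (fun _ => 1) g

/-- The rank of `K/K₀`: `uᵢ = hᵢ⁻¹ ⟨χ_K, φᵢ⟩` (this pairing is an integer). -/
def rank (τ : Gal(K/K₀) ≃* Γ)
    (w : NumberField.InfinitePlace K₀ → NumberField.InfinitePlace K)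
    (φ : Idx Γ → Γ → ℂ) (i : Idx Γ) : ℝ :=
  1 / hDim i.1.2 * (pairing (chiK τ w) (φ i)).re

end Rank

section RandomModule

/-- Finite modules over a ring. -/
structure FinMod (E : Type*) [Ring E] where
  carrier : Type
  [addCommGroup : AddCommGroup carrier]
  [module : Module E carrier]
  [finite : Finite carrier]

attribute [instance] FinMod.addCommGroup FinMod.module FinMod.finite

/-- Isomorphism of finite modules. -/
instance FinMod.setoid (E : Type*) [Ring E] : Setoid (FinMod E) where
  r M N := Nonempty (M.carrier ≃ₗ[E] N.carrier)
  iseqv := ⟨fun _ => ⟨.refl _ _⟩, fun ⟨f⟩ => ⟨f.symm⟩, fun ⟨f⟩ ⟨g⟩ => ⟨f.trans g⟩⟩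

/-- Isomorphism classes of finite modules. -/
abbrev IsoClass (E : Type*) [Ring E] := Quotient (FinMod.setoid E)

variable {Γ : Type*} [Group Γ] [Fintype Γ] {S : Set Nat.Primes}

/-- `|Aut_Γ(G)|`. -/
def autCard (G : FinMod (ReducedRing Γ S)) : ℝ :=
  Nat.card (G.carrier ≃ₗ[ReducedRing Γ S] G.carrier)

/-- The probability, under the law `P`, that a random module is isomorphic to `G`. -/
def prob (P : PMF (IsoClass (ReducedRing Γ S))) (G : FinMod (ReducedRing Γ S)) : ℝ :=
  (P ⟦G⟧).toReal

/-- `P` is the law of the Cohen–Martinet random `(1 - e₁) ℤ_S[Γ]`-module with parameter `u`.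
(Since `x / 0 = 0` while the right-hand side is positive, all probabilities are nonzero.) -/
def IsCohenMartinetLaw (u : Idx Γ → ℝ) (P : PMF (IsoClass (ReducedRing Γ S))) : Prop :=
  ∀ G₁ G₂ : FinMod (ReducedRing Γ S),
    prob P G₁ / prob P G₂ =
      (weight (S := S) G₂.carrier u * autCard G₂) / (weight (S := S) G₁.carrier u * autCard G₁)

end RandomModule

end CohenMartinet

end

/-! Fix an index `i`, put `e = e_i`, let `ρ` afford `φ_i` and let `n` be its degree. For an infinite
place `v` let `ε_v` be the average of the elements of `Γ_v`, so that `H^{Γ_v} = ε_v H`, and let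
`r_v` be the trace of `ρ(ε_v)`, which is the dimension of the `Γ_v`-invariants. Two facts identify
the exponent: `h_i = n` (`hDim_eq`), and Frobenius reciprocity gives `⟨χ_K, φ_i⟩ = ∑ r_v`, the
summand `-1` contributing nothing because `e ≠ e₁`. Hence `u_i = ∑ r_v / n`.

The core is `|e ε_v H|^n = |e H|^{r_v}` for every finite `H` (`card_imSub_pow_eq`). The center of
`eℚ[Γ]` is a field on which `ρ` is injective, so Schur's lemma and a comparison of traces give, with
`sumConj` the sum of all conjugates, `n · sumConj(e ε_v) = r_v |Γ| · e`. This identity descends to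
`ℤ_S[Γ]`, where `e` has coefficients because the numbers `|Γ| e(g)` are integers. Cardinalities of
images of idempotents are multiplicative in short exact sequences, so `H` may be taken cyclic and
killed by some `p ∈ S`. Since `p ∤ |Γ|`, such a module is `𝔽_p[Γ]f` with `f` idempotent, and `|aH|`
is `p` to the rank of `x ↦ a x f`. Over `𝔽_p` a trace sees this rank only modulo `p`; lifting `f` to
`ℤ/p^{k+1}` for every `k` recovers it as an integer (`mul_twoSidedRank_eq`).

Multiplying over `i`, and using that the `e_i` decompose `ε_v H`, yields `∏_v |H^{Γ_v}|`. The
statements on laws are then formal: the zero module fixes the constant, and conjugate decomposition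
groups have equally many fixed points. -/

noncomputable section

namespace CohenMartinet

set_option linter.unusedSectionVars false

/-! ### Primitive central idempotents of a finite-dimensional ℚ-algebra -/

section CentralIdempotents

variable {A : Type*} [Ring A]

/-- The ideal of `y` is generated by an idempotent `f = a y`; as `a` commutes with `y`, `f` is
nilpotent too, hence zero. -/
theorem eq_zero_of_central_of_isNilpotent [IsSemisimpleRing A] {y : A} (hy : y ∈ Set.center A)
    (hn : IsNilpotent y) : y = 0 := by
  obtain ⟨f, hf, hI⟩ := IsSemisimpleRing.ideal_eq_span_idempotent (Ideal.span {y})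
  have h1 : f ∈ Ideal.span {y} := hI ▸ Ideal.mem_span_singleton_self f
  obtain ⟨a, ha⟩ := Ideal.mem_span_singleton'.mp h1
  have h2 : y ∈ Ideal.span {f} := hI ▸ Ideal.mem_span_singleton_self y
  obtain ⟨b, hb⟩ := Ideal.mem_span_singleton'.mp h2
  have hc : Commute a y := ((Semigroup.mem_center_iff.mp hy) a)
  obtain ⟨k, hk⟩ := hn
  have hf0 : f ^ (k + 1) = 0 := by
    rw [← ha, hc.mul_pow, pow_succ y, hk, zero_mul, mul_zero]
  rw [hf.pow_succ_eq] at hf0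
  rw [← hb, hf0, mul_zero]

theorem isNilpotent_mul_one_sub {Z : Type*} [CommRing Z] {y u : Z} {n : ℕ}
    (h : y ^ (n + 1) * u = y ^ n) : IsNilpotent (y * (1 - y * u)) := by
  refine ⟨n + 1, ?_⟩
  have h2 : y ^ n * (1 - y * u) = 0 := by rw [mul_sub, mul_one, ← mul_assoc, ← pow_succ, h, sub_self]
  calc (y * (1 - y * u)) ^ (n + 1) = (y ^ n * (1 - y * u)) * (y * (1 - y * u) ^ n) := by
        rw [mul_pow, pow_succ, pow_succ]; ring
    _ = 0 := by rw [h2, zero_mul]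

/-- The center is Artinian, so the powers of `y` stabilise up to a multiple `u`; then `y(1 - yu)` is
central and nilpotent, hence zero. -/
theorem exists_central_sq_mul_eq [IsSemisimpleRing A] [Algebra ℚ A] [FiniteDimensional ℚ A]
    {y : A} (hy : y ∈ Set.center A) : ∃ u ∈ Set.center A, y * y * u = y := by
  let Z := Subalgebra.center ℚ A
  have : IsArtinianRing Z := IsArtinianRing.of_finite ℚ Z
  obtain ⟨n, u, hu⟩ := IsArtinian.exists_pow_succ_smul_dvd (⟨y, hy⟩ : Z) (1 : Z)
  set y' : Z := ⟨y, hy⟩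
  obtain ⟨k, hk⟩ := isNilpotent_mul_one_sub (y := y') (u := u) (n := n) (by simpa using hu)
  have h3 : y' * (1 - y' * u) = 0 :=
    Subtype.ext (eq_zero_of_central_of_isNilpotent (y' * (1 - y' * u)).2
      ⟨k, congrArg Subtype.val hk⟩)
  refine ⟨u, u.2, ?_⟩
  have h4 : y * (1 - y * u) = 0 := congrArg Subtype.val h3
  rw [mul_sub, mul_one, ← mul_assoc] at h4
  exact (sub_eq_zero.mp h4).symm

/-- With `y²u = y`, the element `yu` is a nonzero central idempotent below `e`, so it is `e`. This
is what makes the center of `eA` a field. -/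
theorem IsIrredCentralIdem.exists_mul_eq [IsSemisimpleRing A] [Algebra ℚ A]
    [FiniteDimensional ℚ A] {e : A} (he : IsIrredCentralIdem e) {y : A} (hy : y ∈ Set.center A)
    (hye : y * e = y) (h0 : y ≠ 0) : ∃ u ∈ Set.center A, y * u = e := by
  obtain ⟨u, hu, h⟩ := exists_central_sq_mul_eq hy
  have hc : y * u = u * y := hy.comm u
  have hid : IsIdempotentElem (y * u) := by
    unfold IsIdempotentElem
    rw [mul_assoc, ← mul_assoc u, ← hc, ← mul_assoc, ← mul_assoc, h]
  have hle : y * u * e = y * u := by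
    rw [hc, mul_assoc, hye]
  rcases he.irred _ hid (Set.mul_mem_center hy hu) hle with h1 | h1
  · rw [mul_assoc, h1, mul_zero] at h
    exact absurd h.symm h0
  · exact ⟨u, hu, h1⟩

/-- Among the nonzero central idempotents `f` below `t`, one with `fA` of least dimension is
primitive. -/
theorem exists_isIrredCentralIdem_mul_eq [Algebra ℚ A] [FiniteDimensional ℚ A] {t : A}
    (ht : IsIdempotentElem t) (htc : t ∈ Set.center A) (ht0 : t ≠ 0) :
    ∃ f : A, IsIrredCentralIdem f ∧ f * t = f := by
  let s : Set A := {f | IsIdempotentElem f ∧ f ∈ Set.center A ∧ f ≠ 0 ∧ f * t = f}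
  let rk : A → ℕ := fun f => Module.finrank ℚ (LinearMap.range (LinearMap.mulLeft ℚ f))
  obtain ⟨f, ⟨hf, hfc, hf0, hft⟩, hmin⟩ :=
    exists_minimalFor_of_wellFoundedLT (· ∈ s) rk ⟨t, ht, htc, ht0, ht.eq⟩
  refine ⟨f, ⟨hf, hfc, hf0, fun g hg hgc hgf => ?_⟩, hft⟩
  by_cases hg0 : g = 0
  · exact Or.inl hg0
  right
  have hle : LinearMap.range (LinearMap.mulLeft ℚ g) ≤ LinearMap.range (LinearMap.mulLeft ℚ f) := by
    rintro _ ⟨x, rfl⟩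
    refine ⟨g * x, ?_⟩
    simp only [LinearMap.mulLeft_apply]
    rw [← mul_assoc, hfc.comm g, hgf]
  have hgs : g ∈ s := ⟨hg, hgc, hg0, by rw [← hgf, mul_assoc, hft]⟩
  have heq := Submodule.eq_of_le_of_finrank_le hle
    (hmin hgs (Submodule.finrank_mono hle))
  have hfm : f ∈ LinearMap.range (LinearMap.mulLeft ℚ f) := ⟨1, by simp⟩
  rw [← heq] at hfm
  obtain ⟨x, hx⟩ := hfm
  simp only [LinearMap.mulLeft_apply] at hx
  rw [← hgf, ← hx, ← mul_assoc, hg.eq]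

theorem orthogonalIdempotents_irredCentralIdem :
    OrthogonalIdempotents (fun e : {e : A // IsIrredCentralIdem e} => e.1) where
  idem e := e.2.idem
  ortho e f h := e.2.mul_eq_zero f.2 fun h' => h (Subtype.ext h')

theorem sum_irredCentralIdem_eq_one [Algebra ℚ A] [FiniteDimensional ℚ A]
    [Fintype {e : A // IsIrredCentralIdem e}] : ∑ e : {e : A // IsIrredCentralIdem e}, e.1 = 1 := by
  set s := ∑ e : {e : A // IsIrredCentralIdem e}, e.1 with hs
  by_contra hne
  have hsi : IsIdempotentElem s := orthogonalIdempotents_irredCentralIdem.isIdempotentElem_sum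
  have hsc : s ∈ Set.center A :=
    (Subring.center A).sum_mem fun e _ => e.2.central
  obtain ⟨f, hf, hft⟩ := exists_isIrredCentralIdem_mul_eq hsi.one_sub
    ((Subring.center A).sub_mem (Subring.center A).one_mem hsc)
    (sub_ne_zero.mpr (Ne.symm hne))
  have hfs : f * s = f := by
    rw [hs, Finset.mul_sum, Finset.sum_eq_single (⟨f, hf⟩ : {e : A // IsIrredCentralIdem e})]
    · exact hf.idem
    · exact fun e _ h => hf.mul_eq_zero e.2 fun h' => h (Subtype.ext h'.symm)
    · simp
  rw [mul_sub, mul_one, hfs, sub_self] at hft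
  exact hf.ne_zero hft.symm

end CentralIdempotents

/-! ### Sums of conjugates and averaging idempotents in group rings -/

section GroupAlgebra

variable {Γ : Type*} [Group Γ] [Fintype Γ] {R : Type*} [CommRing R]

open MonoidAlgebra (single)

theorem mem_center_of_forall_single {z : MonoidAlgebra R Γ}
    (h : ∀ g : Γ, single g 1 * z = z * single g 1) : z ∈ Set.center (MonoidAlgebra R Γ) := by
  rw [Semigroup.mem_center_iff]
  intro x
  induction x using MonoidAlgebra.induction_on with
  | of g => exact h g
  | add a b ha hb => rw [mul_add, add_mul, ha, hb]
  | smul r a ha => rw [mul_smul_comm, smul_mul_assoc, ha]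

/-- The sum of all conjugates of an element of the group ring. -/
def sumConj (x : MonoidAlgebra R Γ) : MonoidAlgebra R Γ :=
  ∑ g : Γ, single g 1 * x * single g⁻¹ 1

theorem sumConj_mem_center (x : MonoidAlgebra R Γ) :
    sumConj x ∈ Set.center (MonoidAlgebra R Γ) := by
  refine mem_center_of_forall_single fun h => ?_
  simp only [sumConj, Finset.mul_sum, Finset.sum_mul]
  refine Fintype.sum_equiv (Equiv.mulLeft h) _ _ fun g => ?_
  simp only [Equiv.coe_mulLeft, mul_assoc, mul_inv_rev, MonoidAlgebra.single_mul_single,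
    inv_mul_cancel, mul_one]
  rw [← mul_assoc (single h 1), MonoidAlgebra.single_mul_single, mul_one]

theorem sumConj_add (x y : MonoidAlgebra R Γ) : sumConj (x + y) = sumConj x + sumConj y := by
  simp only [sumConj, mul_add, add_mul, Finset.sum_add_distrib]

theorem sumConj_central_mul {k : MonoidAlgebra R Γ} (hk : k ∈ Set.center (MonoidAlgebra R Γ))
    (x : MonoidAlgebra R Γ) : sumConj (k * x) = k * sumConj x := by
  simp only [sumConj, Finset.mul_sum]
  refine Finset.sum_congr rfl fun g _ => ?_
  rw [← mul_assoc, ← mul_assoc, ← mul_assoc, (hk.comm (single g 1)).eq]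

theorem coeff_sumConj_one (x : MonoidAlgebra R Γ) :
    (sumConj x).coeff 1 = Fintype.card Γ * x.coeff 1 := by
  simp [sumConj, MonoidAlgebra.coeff_sum]

/-- A trace-like map is constant on conjugates. This transports an identity between sums of
conjugates to traces, hence to ranks. -/
theorem card_smul_eq_sumConj {M : Type*} [AddCommGroup M] (T : MonoidAlgebra R Γ →+ M)
    (hT : ∀ a b, T (a * b) = T (b * a)) (x : MonoidAlgebra R Γ) :
    T (sumConj x) = Fintype.card Γ • T x := by
  simp only [sumConj, map_sum]
  rw [Finset.sum_congr rfl fun g _ => by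
    rw [hT, ← mul_assoc, MonoidAlgebra.single_mul_single, inv_mul_cancel, mul_one,
      ← MonoidAlgebra.one_def, one_mul], Finset.sum_const, Finset.card_univ]

theorem map_sumConj {R' : Type*} [CommRing R'] (f : R →+* R') (x : MonoidAlgebra R Γ) :
    MonoidAlgebra.mapRingHom Γ f (sumConj x) = sumConj (MonoidAlgebra.mapRingHom Γ f x) := by
  simp [sumConj, map_sum]

/-- The idempotent `|Δ|⁻¹ ∑_{δ ∈ Δ} δ`. -/
def subIdem (R : Type*) [CommRing R] (Δ : Subgroup Γ) : MonoidAlgebra R Γ :=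
  Ring.inverse (Nat.card Δ : R) • ∑ᶠ δ : Δ, single δ.1 1

open Classical in
theorem subIdem_def (Δ : Subgroup Γ) :
    subIdem R Δ = Ring.inverse (Nat.card Δ : R) • ∑ δ : Δ, single δ.1 1 := by
  rw [subIdem, finsum_eq_sum_of_fintype]

theorem single_mul_subIdem {Δ : Subgroup Γ} {g : Γ} (hg : g ∈ Δ) :
    single g 1 * subIdem R Δ = subIdem R Δ := by
  classical
  rw [subIdem_def, mul_smul_comm, Finset.mul_sum]
  congr 1
  refine Fintype.sum_equiv (Equiv.mulLeft ⟨g, hg⟩) _ _ fun x => ?_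
  simp [MonoidAlgebra.single_mul_single]

theorem isIdempotentElem_subIdem {Δ : Subgroup Γ} (hΔ : IsUnit (Nat.card Δ : R)) :
    IsIdempotentElem (subIdem R Δ) := by
  classical
  unfold IsIdempotentElem
  conv_lhs => enter [1]; rw [subIdem_def]
  rw [smul_mul_assoc, Finset.sum_mul]
  rw [Finset.sum_congr rfl fun δ _ => single_mul_subIdem δ.2, Finset.sum_const, Finset.card_univ,
    ← Nat.cast_smul_eq_nsmul R, smul_smul, ← Nat.card_eq_fintype_card,
    Ring.inverse_mul_cancel _ hΔ, one_smul]

theorem map_subIdem {R' : Type*} [CommRing R'] (f : R →+* R') {Δ : Subgroup Γ}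
    (hΔ : IsUnit (Nat.card Δ : R)) :
    MonoidAlgebra.mapRingHom Γ f (subIdem R Δ) = subIdem R' Δ := by
  classical
  rw [subIdem_def, subIdem_def]
  ext g
  simp only [MonoidAlgebra.coeff_mapRingHom, MonoidAlgebra.coeff_smul, MonoidAlgebra.coeff_sum,
    Finsupp.smul_apply, smul_eq_mul, map_mul, Finsupp.finsetSum_apply, map_sum,
    MonoidAlgebra.coeff_single]
  congr 1
  · have h : (Nat.card Δ : R') * f (Ring.inverse (Nat.card Δ : R)) = 1 := by
      rw [← map_natCast f, ← map_mul, Ring.mul_inverse_cancel _ hΔ, map_one]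
    have hu : IsUnit (Nat.card Δ : R') := .of_mul_eq_one _ h
    rw [← hu.mul_right_inj, h, Ring.mul_inverse_cancel _ hu]
  · refine Finset.sum_congr rfl fun δ _ => ?_
    simp [Finsupp.single_apply, apply_ite f]

theorem single_mul_e₁ (g : Γ) : single g 1 * e₁ Γ R = e₁ Γ R := by
  rw [e₁, mul_smul_comm, Finset.mul_sum]
  congr 1
  refine Fintype.sum_equiv (Equiv.mulLeft g) _ _ fun x => ?_
  simp [MonoidAlgebra.single_mul_single]

theorem exists_mul_e₁_eq_smul (x : MonoidAlgebra R Γ) : ∃ c : R, x * e₁ Γ R = c • e₁ Γ R := by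
  induction x using MonoidAlgebra.induction_on with
  | of g => exact ⟨1, by rw [one_smul]; exact single_mul_e₁ g⟩
  | add a b ha hb =>
    obtain ⟨c, hc⟩ := ha
    obtain ⟨d, hd⟩ := hb
    exact ⟨c + d, by rw [add_mul, hc, hd, add_smul]⟩
  | smul r a ha =>
    obtain ⟨c, hc⟩ := ha
    exact ⟨r * c, by rw [smul_mul_assoc, hc, smul_smul]⟩

theorem isIdempotentElem_e₁ (h : IsUnit (Fintype.card Γ : R)) : IsIdempotentElem (e₁ Γ R) := by
  unfold IsIdempotentElem
  conv_lhs => enter [1]; rw [e₁]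
  rw [smul_mul_assoc, Finset.sum_mul, Finset.sum_congr rfl fun g _ => single_mul_e₁ g,
    Finset.sum_const, Finset.card_univ, ← Nat.cast_smul_eq_nsmul R, smul_smul,
    Ring.inverse_mul_cancel _ h, one_smul]

theorem isUnit_card_rat : IsUnit (Fintype.card Γ : ℚ) :=
  isUnit_iff_ne_zero.mpr (Nat.cast_ne_zero.mpr Fintype.card_ne_zero)

theorem e₁_ne_zero : e₁ Γ ℚ ≠ 0 := by
  intro h
  have := congrArg (fun x => x.coeff 1) h
  classical
  simp [e₁, MonoidAlgebra.coeff_sum, MonoidAlgebra.coeff_smul, Finsupp.single_apply] at this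

/-- Every multiple of `e₁` is a scalar multiple, so an idempotent below it is `0` or `e₁`. -/
theorem isIrredCentralIdem_e₁ : IsIrredCentralIdem (e₁ Γ ℚ) where
  idem := isIdempotentElem_e₁ isUnit_card_rat
  central := Semigroup.mem_center_iff.mpr fun x => (e₁_central Γ ℚ x).symm
  ne_zero := e₁_ne_zero
  irred f hf hfc h := by
    obtain ⟨c, hc⟩ := exists_mul_e₁_eq_smul f
    rw [h] at hc
    have h2 := hf.eq
    rw [hc, smul_mul_smul_comm, (isIdempotentElem_e₁ isUnit_card_rat).eq] at h2
    have h3 : c * c = c := smul_left_injective ℚ e₁_ne_zero h2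
    by_cases hc0 : c = 0
    · left; rw [hc, hc0, zero_smul]
    · right; rw [hc, mul_left_cancel₀ hc0 (h3.trans (mul_one c).symm), one_smul]

end GroupAlgebra

/-! ### Complex representations viewed on ℚ[Γ]: Schur, density, characters -/

section Representations

variable {Γ : Type*} [Group Γ] [Fintype Γ]

open MonoidAlgebra (single)

theorem asAlgebraHom_eq_sum {k V : Type*} [Field k] [AddCommGroup V] [Module k V]
    (σ : Representation k Γ V) (x : MonoidAlgebra k Γ) :
    σ.asAlgebraHom x = ∑ g, x.coeff g • σ g := by
  rw [Representation.asAlgebraHom_def, MonoidAlgebra.lift_apply,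
    Finsupp.sum_fintype _ _ (by simp)]

section RatHom

variable {V : Type*} [AddCommGroup V] [Module ℂ V] (ρ : Representation ℂ Γ V)

/-- The action of `ℚ[Γ]` through a complex representation. -/
def ratHom : MonoidAlgebra ℚ Γ →+* Module.End ℂ V :=
  ρ.asAlgebraHom.toRingHom.comp (MonoidAlgebra.mapRingHom Γ (algebraMap ℚ ℂ))

theorem ratHom_single (g : Γ) (r : ℚ) : ratHom ρ (single g r) = (r : ℂ) • ρ g := by
  simp [ratHom, Representation.asAlgebraHom_single]

theorem ratHom_smul (c : ℚ) (x : MonoidAlgebra ℚ Γ) : ratHom ρ (c • x) = (c : ℂ) • ratHom ρ x := by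
  induction x using MonoidAlgebra.induction_linear with
  | zero => simp
  | add a b ha hb => simp only [smul_add, map_add, ha, hb]
  | single g r => simp only [MonoidAlgebra.smul_single, ratHom_single, smul_eq_mul, smul_smul,
      Rat.cast_mul]

theorem ratHom_eq_sum (x : MonoidAlgebra ℚ Γ) :
    ratHom ρ x = ∑ g, (x.coeff g : ℂ) • ρ g := by
  change ρ.asAlgebraHom (MonoidAlgebra.mapRingHom Γ (algebraMap ℚ ℂ) x) = _
  rw [asAlgebraHom_eq_sum]
  simp

/-- The trace of the action of an element of `ℚ[Γ]`. -/
def ratTrace : MonoidAlgebra ℚ Γ →+ ℂ :=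
  (LinearMap.trace ℂ V).toAddMonoidHom.comp (ratHom ρ).toAddMonoidHom

theorem ratTrace_apply (x : MonoidAlgebra ℚ Γ) :
    ratTrace ρ x = LinearMap.trace ℂ V (ratHom ρ x) := rfl

theorem ratTrace_single (g : Γ) (r : ℚ) : ratTrace ρ (single g r) = r * ρ.character g := by
  rw [ratTrace_apply, ratHom_single, map_smul, smul_eq_mul, Representation.character]

theorem ratTrace_smul (c : ℚ) (x : MonoidAlgebra ℚ Γ) :
    ratTrace ρ (c • x) = c * ratTrace ρ x := by
  rw [ratTrace_apply, ratHom_smul, map_smul, smul_eq_mul, ratTrace_apply]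

theorem ratTrace_mul_comm (a b : MonoidAlgebra ℚ Γ) : ratTrace ρ (a * b) = ratTrace ρ (b * a) := by
  rw [ratTrace_apply, ratTrace_apply, map_mul (ratHom ρ), map_mul (ratHom ρ), LinearMap.trace_mul_comm]

theorem ratTrace_of_isIdempotentElem [FiniteDimensional ℂ V] {x : MonoidAlgebra ℚ Γ}
    (hx : IsIdempotentElem x) :
    ratTrace ρ x = Module.finrank ℂ (LinearMap.range (ratHom ρ x)) :=
  (LinearMap.IsIdempotentElem.isProj_range _ (hx.map (ratHom ρ))).trace

variable [FiniteDimensional ℂ V] [ρ.IsIrreducible]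

theorem exists_eq_smul_one_of_commute {f : Module.End ℂ V} (hf : ∀ g, Commute f (ρ g)) :
    ∃ c : ℂ, f = c • 1 := by
  let F : Representation.IntertwiningMap ρ ρ :=
    ⟨f, fun g => (hf g).eq⟩
  obtain ⟨c, hc⟩ :=
    (Representation.IsIrreducible.algebraMap_intertwiningMap_bijective_of_isAlgClosed
      (ρ := ρ)).2 F
  refine ⟨c, ?_⟩
  have := congrArg Representation.IntertwiningMap.toLinearMap hc
  rw [Algebra.algebraMap_eq_smul_one] at this
  exact this.symm

theorem exists_ratHom_eq_smul_one {z : MonoidAlgebra ℚ Γ}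
    (hz : z ∈ Set.center (MonoidAlgebra ℚ Γ)) : ∃ c : ℂ, ratHom ρ z = c • 1 := by
  refine exists_eq_smul_one_of_commute ρ fun g => ?_
  have := (hz.comm (single g 1)).map (ratHom ρ)
  simpa [ratHom_single] using this

omit [FiniteDimensional ℂ V] in
include ρ in
theorem nontrivial_of_isIrreducible : Nontrivial V := by
  have : IsSimpleModule (MonoidAlgebra ℂ Γ) ρ.asModule := inferInstance
  exact IsSimpleModule.nontrivial (MonoidAlgebra ℂ Γ) ρ.asModule

theorem ratHom_eq_zero_or_one {e : MonoidAlgebra ℚ Γ} (he : IsIrredCentralIdem e) :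
    ratHom ρ e = 0 ∨ ratHom ρ e = 1 := by
  have := nontrivial_of_isIrreducible ρ
  obtain ⟨c, hc⟩ := exists_ratHom_eq_smul_one ρ he.central
  have h := (he.idem.map (ratHom ρ)).eq
  rw [hc, smul_mul_smul_comm, one_mul] at h
  have h3 : c * c = c := smul_left_injective ℂ one_ne_zero h
  by_cases hc0 : c = 0
  · left; rw [hc, hc0, zero_smul]
  · right; rw [hc, mul_left_cancel₀ hc0 (h3.trans (mul_one c).symm), one_smul]

/-- A nonzero `y` would divide `e`, which acts as the identity. Thus identities between central
elements of `eℚ[Γ]` can be checked after applying `ρ`. -/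
theorem ratHom_eq_zero_iff {e y : MonoidAlgebra ℚ Γ} (he : IsIrredCentralIdem e)
    (h1 : ratHom ρ e = 1) (hy : y ∈ Set.center (MonoidAlgebra ℚ Γ)) (hye : y * e = y)
    (h : ratHom ρ y = 0) : y = 0 := by
  have := nontrivial_of_isIrreducible ρ
  by_contra h0
  have : NeZero (Nat.card Γ : ℚ) := ⟨by simp⟩
  have : FiniteDimensional ℚ (MonoidAlgebra ℚ Γ) := inferInstance
  obtain ⟨u, -, hu⟩ := he.exists_mul_eq hy hye h0
  have h2 := congrArg (ratHom ρ) hu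
  rw [map_mul, h, zero_mul, h1] at h2
  exact zero_ne_one h2

/-- By Schur the sum of conjugates acts as a scalar, which its trace determines; the factor `dim V`
avoids a division. -/
theorem ratHom_sumConj (x : MonoidAlgebra ℚ Γ) :
    (Module.finrank ℂ V : ℂ) • ratHom ρ (sumConj x) = (Fintype.card Γ * ratTrace ρ x) • 1 := by
  obtain ⟨c, hc⟩ := exists_ratHom_eq_smul_one ρ (sumConj_mem_center x)
  have h := card_smul_eq_sumConj (ratTrace ρ) (ratTrace_mul_comm ρ) x
  rw [ratTrace_apply, hc, map_smul, LinearMap.trace_one, smul_eq_mul, nsmul_eq_mul] at h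
  rw [hc, smul_smul, mul_comm, h]

/-- If a rational number `r` is the trace of `x`, then the sum of the conjugates of `e x` is
`r |Γ| / n` times `e`. -/
theorem sumConj_mul_eq {e x : MonoidAlgebra ℚ Γ} (he : IsIrredCentralIdem e)
    (h1 : ratHom ρ e = 1) {r : ℕ} (hr : ratTrace ρ x = r) :
    Module.finrank ℂ V • sumConj (e * x) = (r * Fintype.card Γ) • e := by
  have hc : sumConj (e * x) ∈ Set.center (MonoidAlgebra ℚ Γ) := sumConj_mem_center _
  rw [← sub_eq_zero]
  refine ratHom_eq_zero_iff ρ he h1 ?_ ?_ ?_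
  · exact (Subring.center _).sub_mem ((Subring.center _).nsmul_mem hc _)
      ((Subring.center _).nsmul_mem he.central _)
  · rw [sub_mul, smul_mul_assoc, smul_mul_assoc, he.idem.eq, (hc.comm e).eq,
      sumConj_central_mul he.central, ← mul_assoc, he.idem.eq]
  · rw [map_sub, map_nsmul, map_nsmul, sumConj_central_mul he.central, map_mul, h1, one_mul,
      ← Nat.cast_smul_eq_nsmul ℂ, ratHom_sumConj, hr, ← Nat.cast_smul_eq_nsmul ℂ, sub_eq_zero,
      Nat.cast_mul, mul_comm]

/-- By Schur the endomorphisms of the simple module are the complex scalars, so any linear `f`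
commutes with them; Jacobson density realises `f` on a basis. -/
theorem asAlgebraHom_surjective : Function.Surjective ρ.asAlgebraHom := by
  intro f
  let F : Module.End (Module.End (MonoidAlgebra ℂ Γ) ρ.asModule) ρ.asModule :=
    { toFun := fun v => ρ.asModuleEquiv.symm (f (ρ.asModuleEquiv v))
      map_add' := fun v w => by simp only [map_add]
      map_smul' := fun c v => by
        obtain ⟨a, rfl⟩ := (IsSimpleModule.algebraMap_end_bijective_of_isAlgClosed
          (A := MonoidAlgebra ℂ Γ) (V := ρ.asModule) ℂ).2 c
        change ρ.asModuleEquiv.symm (f (ρ.asModuleEquiv (a • v))) =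
          a • ρ.asModuleEquiv.symm (f (ρ.asModuleEquiv v))
        simp only [map_smul] }
  let b := Module.finBasis ℂ V
  classical
  obtain ⟨r, hr⟩ := jacobson_density F (Finset.univ.image fun i => ρ.asModuleEquiv.symm (b i))
  refine ⟨r, b.ext fun i => ?_⟩
  have h := congrArg ρ.asModuleEquiv (hr _ (Finset.mem_image_of_mem _ (Finset.mem_univ i)))
  rw [Representation.asModuleEquiv_map_smul] at h
  simpa [F] using h.symm

theorem span_ratHom_eq_top : Submodule.span ℂ (Set.range (ratHom ρ)) = ⊤ := by
  rw [eq_top_iff]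
  rintro f -
  obtain ⟨x, rfl⟩ := asAlgebraHom_surjective ρ f
  rw [asAlgebraHom_eq_sum]
  refine Submodule.sum_mem _ fun g _ => Submodule.smul_mem _ _ (Submodule.subset_span
    ⟨single g 1, ?_⟩)
  simp [ratHom_single]

end RatHom

section ConjTrace

/-- The averaged form `P = ∑ M(h)ᴴ M(h)` is invariant, and definite because of the term `h = 1`.
Hence `M(g⁻¹) = P⁻¹ M(g)ᴴ P`, and traces agree. -/
theorem trace_inv_eq_conj {n : ℕ} (ρ : Representation ℂ Γ (Fin n → ℂ)) (g : Γ) :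
    ρ.character g⁻¹ = conj (ρ.character g) := by
  open scoped ComplexOrder in
  let M : Γ → Matrix (Fin n) (Fin n) ℂ := fun h => LinearMap.toMatrix' (ρ h)
  have hM (a b : Γ) : M (a * b) = M a * M b := by
    simp only [M, map_mul, LinearMap.toMatrix'_mul]
  have hM1 : M 1 = 1 := by simp only [M, map_one, LinearMap.toMatrix'_one]
  have htr (h : Γ) : ρ.character h = (M h).trace := by
    simp only [M, Representation.character]
    rw [LinearMap.trace_eq_matrix_trace ℂ (Pi.basisFun ℂ (Fin n)),
      LinearMap.toMatrix_eq_toMatrix']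
  let P : Matrix (Fin n) (Fin n) ℂ := ∑ h, (M h).conjTranspose * M h
  have hP : P.PosDef := by
    classical
    rw [show P = (M 1).conjTranspose * M 1 + ∑ h ∈ Finset.univ.erase 1, (M h).conjTranspose * M h
      from (Finset.add_sum_erase _ _ (Finset.mem_univ 1)).symm]
    refine Matrix.PosDef.add_posSemidef ?_ (Matrix.posSemidef_sum _ fun h _ =>
      Matrix.posSemidef_conjTranspose_mul_self _)
    rw [hM1, Matrix.conjTranspose_one, one_mul]
    exact Matrix.PosDef.one
  have hinv : (M g).conjTranspose * P * M g = P := by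
    simp only [P, Finset.mul_sum, Finset.sum_mul]
    refine Fintype.sum_equiv (Equiv.mulRight g) _ _ fun h => ?_
    simp only [Equiv.coe_mulRight, hM, Matrix.conjTranspose_mul, mul_assoc]
  have hg : M g * M g⁻¹ = 1 := by rw [← hM, mul_inv_cancel, hM1]
  have h1 : P * M g⁻¹ = (M g).conjTranspose * P := by
    conv_lhs => rw [← hinv, mul_assoc, hg, mul_one]
  have hu : IsUnit P.det := (Matrix.isUnit_iff_isUnit_det P).mp hP.isUnit
  have h2 : M g⁻¹ = P⁻¹ * ((M g).conjTranspose * P) := by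
    rw [← h1, ← mul_assoc, Matrix.nonsing_inv_mul _ hu, one_mul]
  rw [htr, htr, h2, Matrix.trace_mul_comm, mul_assoc, Matrix.mul_nonsing_inv _ hu, mul_one,
    Matrix.trace_conjTranspose]
  rfl

end ConjTrace

theorem ratTrace_subIdem {V : Type*} [AddCommGroup V] [Module ℂ V] (ρ : Representation ℂ Γ V)
    (Δ : Subgroup Γ) :
    ratTrace ρ (subIdem ℚ Δ) = (Nat.card Δ : ℂ)⁻¹ * ∑ᶠ δ : Δ, ρ.character δ := by
  classical
  rw [subIdem_def, ratTrace_smul, finsum_eq_sum_of_fintype, map_sum]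
  simp [ratTrace_single]

theorem ratTrace_e₁ {V : Type*} [AddCommGroup V] [Module ℂ V] (ρ : Representation ℂ Γ V) :
    ratTrace ρ (e₁ Γ ℚ) = (Fintype.card Γ : ℂ)⁻¹ * ∑ g : Γ, ρ.character g := by
  rw [e₁, ratTrace_smul, map_sum]
  simp [ratTrace_single]

theorem pairing_add_left (χ χ' ψ : Γ → ℂ) : pairing (χ + χ') ψ = pairing χ ψ + pairing χ' ψ := by
  simp [pairing, add_mul, Finset.sum_add_distrib, mul_add]

theorem pairing_sum_left {ι : Type*} (s : Finset ι) (χ : ι → Γ → ℂ) (ψ : Γ → ℂ) :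
    pairing (∑ i ∈ s, χ i) ψ = ∑ i ∈ s, pairing (χ i) ψ := by
  simp only [pairing, Finset.sum_apply, Finset.sum_mul, ← Finset.mul_sum]
  rw [Finset.sum_comm]

/-- Frobenius reciprocity: substituting `g ↦ x g x⁻¹` makes the inner sum independent of `x`, and
the `|Γ|` equal terms cancel the normalisation. -/
theorem pairing_induced {V : Type*} [AddCommGroup V] [Module ℂ V] (ρ : Representation ℂ Γ V)
    (Δ : Subgroup Γ) :
    pairing (induced Δ fun _ => 1) ρ.character = conj (ratTrace ρ (subIdem ℚ Δ)) := by
  classical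
  rw [ratTrace_subIdem, finsum_eq_sum_of_fintype, pairing]
  simp only [induced, dite_eq_ite, map_mul, map_inv₀, Complex.conj_natCast, map_sum]
  have h (x : Γ) : ∑ g : Γ, (if x⁻¹ * g * x ∈ Δ then (1 : ℂ) else 0) * conj (ρ.character g) =
      ∑ δ : Δ, conj (ρ.character δ) := by
    rw [← Equiv.sum_comp (MulAut.conj x).toEquiv]
    simp only [MulEquiv.toEquiv_eq_coe, EquivLike.coe_coe, MulAut.conj_apply,
      Representation.char_conj]
    simp only [mul_assoc, inv_mul_cancel, mul_one, inv_mul_cancel_left, ite_mul, one_mul, zero_mul]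
    rw [← Finset.sum_filter, Finset.sum_subtype (p := (· ∈ Δ)) _ (by simp)]
  simp_rw [mul_assoc (Nat.card Δ : ℂ)⁻¹, Finset.sum_mul]
  rw [← Finset.mul_sum, Finset.sum_comm, Finset.sum_congr rfl fun x _ => h x, Finset.sum_const, Finset.card_univ,
    nsmul_eq_mul]
  field_simp

/-- A rational representation on which `e` acts as the identity is orthogonal to a complex
representation on which `e` acts as zero. -/
theorem pairing_eq_zero {n m : ℕ} (σ : Representation ℚ Γ (Fin m → ℚ))
    (ρ : Representation ℂ Γ (Fin n → ℂ)) {e : MonoidAlgebra ℚ Γ} (hσ : σ.asAlgebraHom e = 1)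
    (hρ : ratHom ρ e = 0) : pairing (fun g => (σ.character g : ℂ)) ρ.character = 0 := by
  -- Insert `e` into `σ`, where it acts as `1`; reindexing the convolution moves the coefficients of
  -- `e` onto `ρ`, where it acts as `0`.
  have h1 (g : Γ) : (σ.character g : ℂ) = ∑ k, (e.coeff k : ℂ) * (σ.character (k * g) : ℂ) := by
    have h : σ g = ∑ k, e.coeff k • σ (k * g) := by
      conv_lhs => rw [← one_mul (σ g), ← hσ, asAlgebraHom_eq_sum, Finset.sum_mul]
      simp only [smul_mul_assoc, map_mul]
    conv_lhs => rw [Representation.character, h, map_sum]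
    simp [Representation.character]
  have h2 (g : Γ) : ∑ k, (e.coeff k : ℂ) * ρ.character (g * k) = 0 := by
    have h : ∑ k, (e.coeff k : ℂ) • ρ (g * k) = 0 := by
      rw [← mul_zero (ρ g), ← hρ, ratHom_eq_sum, Finset.mul_sum]
      simp only [mul_smul_comm, map_mul]
    have h' := congrArg (LinearMap.trace ℂ _) h
    simpa [Representation.character] using h'
  rw [pairing]
  simp only [← trace_inv_eq_conj]
  rw [Finset.sum_congr rfl fun g _ => by rw [h1 g, Finset.sum_mul], Finset.sum_comm]
  have h3 (k : Γ) : ∑ g, (e.coeff k : ℂ) * (σ.character (k * g) : ℂ) * ρ.character g⁻¹ =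
      ∑ g, (e.coeff k : ℂ) * (σ.character g : ℂ) * ρ.character (g⁻¹ * k) := by
    refine Fintype.sum_equiv (Equiv.mulLeft k) _ _ fun g => ?_
    simp
  rw [Finset.sum_congr rfl fun k _ => h3 k, Finset.sum_comm,
    Finset.sum_eq_zero fun g _ => ?_, mul_zero]
  rw [Finset.sum_congr rfl fun k _ => by rw [mul_right_comm, mul_comm], ← Finset.mul_sum, h2,
    mul_zero]

theorem ratHom_eq_one_of_isAbsIrredCharIn {n : ℕ} (ρ : Representation ℂ Γ (Fin n → ℂ))
    (hρ : ρ.IsIrreducible) {e : MonoidAlgebra ℚ Γ} (he : IsIrredCentralIdem e)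
    (h : IsAbsIrredCharIn e ρ.character) : ratHom ρ e = 1 := by
  obtain ⟨-, χ, ⟨m, σ, -, hσ, rfl⟩, hne⟩ := h
  exact (ratHom_eq_zero_or_one ρ he).resolve_left fun h0 => hne (pairing_eq_zero σ ρ hσ h0)

theorem ratTrace_e₁_eq_zero {V : Type*} [AddCommGroup V] [Module ℂ V] (ρ : Representation ℂ Γ V)
    {e : MonoidAlgebra ℚ Γ} (he : IsIrredCentralIdem e) (hne : e ≠ e₁ Γ ℚ) (h : ratHom ρ e = 1) :
    ratTrace ρ (e₁ Γ ℚ) = 0 := by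
  have h1 := congrArg (ratHom ρ) (he.mul_eq_zero isIrredCentralIdem_e₁ hne)
  rw [map_mul, h, one_mul, map_zero] at h1
  rw [ratTrace_apply, h1, map_zero]

end Representations

/-! ### The number `h` is the degree of the absolutely irreducible character -/

section CornerDim

variable {Γ : Type*} [Group Γ] [Fintype Γ] {e : MonoidAlgebra ℚ Γ}

open MonoidAlgebra (single)

/-- `e x` as an element of the corner ring of a central idempotent `e`. -/
def IsIrredCentralIdem.toCorner (he : IsIrredCentralIdem e) (x : MonoidAlgebra ℚ Γ) :
    he.idem.Corner :=
  ⟨e * x, x, by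
    change e * x * e = e * x
    rw [mul_assoc, ← (he.central.comm x).eq, ← mul_assoc, he.idem.eq]⟩

theorem corner_mul (he : IsIrredCentralIdem e) (x : he.idem.Corner) : e * x.1 = x.1 :=
  ((Subsemigroup.mem_corner_iff he.idem).mp x.2).1

theorem corner_mul_right (he : IsIrredCentralIdem e) (x : he.idem.Corner) : x.1 * e = x.1 :=
  ((Subsemigroup.mem_corner_iff he.idem).mp x.2).2

/-- The inclusion of the corner ring, as an additive map. -/
def cornerVal (he : IsIrredCentralIdem e) : he.idem.Corner →+ MonoidAlgebra ℚ Γ where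
  toFun x := x.1
  map_zero' := rfl
  map_add' _ _ := rfl

theorem toCorner_mem_center (he : IsIrredCentralIdem e) {z : MonoidAlgebra ℚ Γ}
    (hz : z ∈ Set.center (MonoidAlgebra ℚ Γ)) :
    he.toCorner z ∈ Subring.center he.idem.Corner := by
  rw [Subring.mem_center_iff]
  intro x
  refine Subtype.ext ?_
  change x.1 * (e * z) = (e * z) * x.1
  rw [((Set.mul_mem_center he.central hz).comm x.1).eq]

theorem mem_center_of_mem_center_corner (he : IsIrredCentralIdem e)
    (z : Subring.center he.idem.Corner) : z.1.1 ∈ Set.center (MonoidAlgebra ℚ Γ) := by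
  rw [Semigroup.mem_center_iff]
  intro x
  have h := congrArg Subtype.val (Subring.mem_center_iff.mp z.2 (he.toCorner x))
  change (e * x) * z.1.1 = z.1.1 * (e * x) at h
  rw [(he.central.comm x).eq, mul_assoc, corner_mul he] at h
  rw [h, ← (he.central.comm x).eq, ← mul_assoc, corner_mul_right he]

theorem isField_center_corner (he : IsIrredCentralIdem e) :
    IsField (Subring.center he.idem.Corner) where
  exists_pair_ne := ⟨0, 1, fun h => he.ne_zero (congrArg (fun z => z.1.1) h).symm⟩
  mul_comm := mul_comm
  mul_inv_cancel := by
    intro z hz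
    have hz0 : z.1.1 ≠ 0 := fun h => hz (Subtype.ext (Subtype.ext h))
    have : NeZero (Nat.card Γ : ℚ) := ⟨by simp⟩
    obtain ⟨u, hu, h⟩ := he.exists_mul_eq (mem_center_of_mem_center_corner he z)
      (corner_mul_right he z.1) hz0
    refine ⟨⟨he.toCorner u, toCorner_mem_center he hu⟩, Subtype.ext (Subtype.ext ?_)⟩
    change z.1.1 * (e * u) = e
    rw [← mul_assoc, corner_mul_right he, h]

/-- The `Z`-valued symmetric form `(a, b) ↦ ∑ g a b g⁻¹` on the corner ring with center `Z`. -/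
def conjForm (he : IsIrredCentralIdem e) :
    LinearMap.BilinForm (Subring.center he.idem.Corner) he.idem.Corner :=
  LinearMap.mk₂ _ (fun a b => ⟨he.toCorner (sumConj (a.1 * b.1)),
      toCorner_mem_center he (sumConj_mem_center _)⟩)
    (fun a a' b => Subtype.ext (Subtype.ext (by
      change e * sumConj ((a.1 + a'.1) * b.1) = e * sumConj (a.1 * b.1) + e * sumConj (a'.1 * b.1)
      rw [add_mul, sumConj_add, mul_add])))
    (fun c a b => Subtype.ext (Subtype.ext (by
      change e * sumConj ((c.1.1 * a.1) * b.1) = c.1.1 * (e * sumConj (a.1 * b.1))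
      rw [mul_assoc, sumConj_central_mul (mem_center_of_mem_center_corner he c), ← mul_assoc,
        ← mul_assoc, corner_mul he, corner_mul_right he])))
    (fun a b b' => Subtype.ext (Subtype.ext (by
      change e * sumConj (a.1 * (b.1 + b'.1)) = e * sumConj (a.1 * b.1) + e * sumConj (a.1 * b'.1)
      rw [mul_add, sumConj_add, mul_add])))
    (fun c a b => Subtype.ext (Subtype.ext (by
      change e * sumConj (a.1 * (c.1.1 * b.1)) = c.1.1 * (e * sumConj (a.1 * b.1))
      rw [← mul_assoc, ← ((mem_center_of_mem_center_corner he c).comm a.1).eq, mul_assoc,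
        sumConj_central_mul (mem_center_of_mem_center_corner he c), ← mul_assoc,
        ← mul_assoc, corner_mul he, corner_mul_right he])))

theorem conjForm_val (he : IsIrredCentralIdem e) (a b : he.idem.Corner) :
    (conjForm he a b).1.1 = sumConj (a.1 * b.1) := by
  change e * sumConj (a.1 * b.1) = _
  rw [← sumConj_central_mul he.central, ← mul_assoc, corner_mul he]

/-- The coefficient of `a` at `g` is that of `a g⁻¹` at `1`, and summing conjugates multiplies the
latter by `|Γ|`. -/
theorem eq_zero_of_forall_sumConj {a : MonoidAlgebra ℚ Γ} (he : IsIrredCentralIdem e)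
    (hea : e * a = a)
    (h : ∀ b : he.idem.Corner, sumConj (a * b.1) = 0) : a = 0 := by
  ext g
  have h1 := congrArg (fun x => x.coeff 1) (h (he.toCorner (single g⁻¹ 1)))
  have h2 : a * (he.toCorner (single g⁻¹ 1)).1 = a * single g⁻¹ 1 := by
    change a * (e * single g⁻¹ 1) = _
    rw [← mul_assoc, ← (he.central.comm a).eq, hea]
  simp only [h2, coeff_sumConj_one] at h1
  simpa using h1

theorem sumConj_mul_comm {R : Type*} [CommRing R] (a b : MonoidAlgebra R Γ) :
    sumConj (a * b) = sumConj (b * a) := by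
  induction b using MonoidAlgebra.induction_linear with
  | zero => simp
  | add x y hx hy => rw [mul_add, add_mul, sumConj_add, sumConj_add, hx, hy]
  | single h r =>
    have hr : (single h r : MonoidAlgebra R Γ) = single 1 r * single h 1 := by
      simp [MonoidAlgebra.single_mul_single]
    have hc : (single 1 r : MonoidAlgebra R Γ) ∈ Set.center _ :=
      mem_center_of_forall_single fun h => (MonoidAlgebra.single_one_comm _ _).symm
    rw [hr, ← mul_assoc, ← (hc.comm a).eq, mul_assoc, mul_assoc, sumConj_central_mul hc,
      sumConj_central_mul hc]
    congr 1
    refine Fintype.sum_equiv (Equiv.mulRight h⁻¹) _ _ fun g => ?_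
    simp only [Equiv.coe_mulRight, mul_inv_rev, inv_inv, mul_assoc]
    rw [← mul_assoc (single (g * h⁻¹) 1), MonoidAlgebra.single_mul_single,
      MonoidAlgebra.single_mul_single, inv_mul_cancel_right, mul_one]

theorem conjForm_nondegenerate (he : IsIrredCentralIdem e) : (conjForm he).Nondegenerate := by
  refine ⟨fun a h => ?_, fun a h => ?_⟩
  · refine Subtype.ext (eq_zero_of_forall_sumConj he (corner_mul he a) fun b => ?_)
    rw [← conjForm_val he, h b]
    rfl
  · refine Subtype.ext (eq_zero_of_forall_sumConj he (corner_mul he a) fun b => ?_)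
    rw [sumConj_mul_comm, ← conjForm_val he, h b]
    rfl

theorem span_range_toCorner (he : IsIrredCentralIdem e) :
    Submodule.span (Subring.center he.idem.Corner)
      (Set.range fun g : Γ => he.toCorner (single g 1)) = ⊤ := by
  rw [eq_top_iff]
  rintro x -
  have hc (g : Γ) : (single 1 (x.1.coeff g) : MonoidAlgebra ℚ Γ) ∈ Set.center _ :=
    mem_center_of_forall_single fun h => (MonoidAlgebra.single_one_comm _ _).symm
  have hx : x = ∑ g : Γ, (⟨he.toCorner (single 1 (x.1.coeff g)), toCorner_mem_center he (hc g)⟩ :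
      Subring.center he.idem.Corner) • he.toCorner (single g 1) := by
    apply Subtype.ext
    change cornerVal he x = cornerVal he _
    rw [map_sum]
    change x.1 = ∑ g, e * single 1 (x.1.coeff g) * (e * single g 1)
    have hg (g : Γ) : e * single 1 (x.1.coeff g) * (e * single g 1) = e * single g (x.1.coeff g) := by
      rw [((Set.mul_mem_center he.central (hc g)).comm _).eq, mul_assoc, ← mul_assoc (single g 1),
        ← (he.central.comm (single g 1)).eq, mul_assoc, ← mul_assoc e e, he.idem.eq,
        MonoidAlgebra.single_mul_single, mul_one, one_mul]
    have hs : x.1 = ∑ g, single g (x.1.coeff g) := by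
      conv_lhs => rw [← MonoidAlgebra.sum_coeff_single x.1]
      exact Finsupp.sum_fintype _ _ (by simp)
    rw [Finset.sum_congr rfl fun g _ => hg g, ← Finset.mul_sum, ← hs, corner_mul he x]
  rw [hx]
  exact Submodule.sum_mem _ fun g _ => Submodule.smul_mem _ _ (Submodule.subset_span ⟨g, rfl⟩)

variable {V : Type*} [AddCommGroup V] [Module ℂ V] [FiniteDimensional ℂ V]

/-- A basis `b` of `eℚ[Γ]` over its center maps to a complex basis of `End V`. It is independent
because, for the dual basis `d` of `conjForm`, the trace of `ρ(d_j b_i)` is `dim V / |Γ|` if `i = j`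
and `0` otherwise. It spans because the center acts by scalars and `ρ(ℚ[Γ])` spans `End V`. -/
theorem finrank_center_corner (he : IsIrredCentralIdem e) (ρ : Representation ℂ Γ V)
    [ρ.IsIrreducible] (h1 : ratHom ρ e = 1) :
    Module.finrank (Subring.center he.idem.Corner) he.idem.Corner = Module.finrank ℂ V ^ 2 := by
  have := nontrivial_of_isIrreducible ρ
  let _ : Field (Subring.center he.idem.Corner) := (isField_center_corner he).toField
  have hfin : Module.Finite (Subring.center he.idem.Corner) he.idem.Corner :=
    ⟨Submodule.fg_def.mpr ⟨_, Set.finite_range _, span_range_toCorner he⟩⟩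
  let b := Module.finBasis (Subring.center he.idem.Corner) he.idem.Corner
  let d := (conjForm he).dualBasis (conjForm_nondegenerate he) b
  have hd (i j) : sumConj ((d i).1 * (b j).1) = if j = i then e else 0 := by
    rw [← conjForm_val he, LinearMap.BilinForm.apply_dualBasis_left]
    split_ifs <;> rfl
  have hli : LinearIndependent ℂ fun i => ratHom ρ (b i).1 := by
    rw [Fintype.linearIndependent_iff]
    intro c hc j
    have h2 : ∑ i, c i * ratTrace ρ ((d j).1 * (b i).1) = 0 := by
      have := congrArg (fun f => LinearMap.trace ℂ V (ratHom ρ (d j).1 * f)) hc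
      simpa [Finset.mul_sum, ratTrace_apply] using this
    have h3 (i) : (Fintype.card Γ : ℂ) * ratTrace ρ ((d j).1 * (b i).1) =
        if i = j then (Module.finrank ℂ V : ℂ) else 0 := by
      rw [← nsmul_eq_mul, ← card_smul_eq_sumConj _ (ratTrace_mul_comm ρ), hd]
      split_ifs
      · rw [ratTrace_apply, h1, LinearMap.trace_one]
      · exact map_zero _
    have h4 := congrArg ((Fintype.card Γ : ℂ) * ·) h2
    simp only [Finset.mul_sum, mul_left_comm (Fintype.card Γ : ℂ), h3] at h4
    simpa [Module.finrank_pos.ne'] using h4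
  have hsp : ⊤ ≤ Submodule.span ℂ (Set.range fun i => ratHom ρ (b i).1) := by
    rw [← span_ratHom_eq_top ρ, Submodule.span_le]
    rintro _ ⟨x, rfl⟩
    have hx : ratHom ρ x = ratHom ρ (he.toCorner x).1 := by
      change _ = ratHom ρ (e * x)
      rw [map_mul, h1, one_mul]
    have hs : (he.toCorner x).1 = ∑ i, (b.repr (he.toCorner x) i).1.1 * (b i).1 := by
      conv_lhs => rw [← b.sum_repr (he.toCorner x)]
      exact map_sum (cornerVal he) _ _
    rw [hx, hs, map_sum]
    refine Submodule.sum_mem _ fun i _ => ?_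
    obtain ⟨c, hc⟩ := exists_ratHom_eq_smul_one ρ
      (mem_center_of_mem_center_corner he (b.repr (he.toCorner x) i))
    rw [map_mul, hc, smul_mul_assoc, one_mul]
    exact Submodule.smul_mem _ _ (Submodule.subset_span ⟨i, rfl⟩)
  have hB := Module.finrank_eq_card_basis (Module.Basis.mk hli hsp)
  rw [Module.finrank_linearMap, Fintype.card_fin] at hB
  rw [sq, hB]

theorem hDim_eq (he : IsIrredCentralIdem e) (ρ : Representation ℂ Γ V) [ρ.IsIrreducible]
    (h1 : ratHom ρ e = 1) : hDim he = Module.finrank ℂ V := by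
  rw [hDim, finrank_center_corner he ρ h1, Nat.cast_pow, Real.sqrt_sq (Nat.cast_nonneg _)]

end CornerDim

/-! ### Central idempotents have coefficients in `|Γ|⁻¹ℤ` -/

section Integrality

/-- Every complex eigenvalue satisfies `μ ^ (N + 1) = μ`, so the trace is a sum of algebraic
integers. -/
theorem isIntegral_trace_of_pow_succ_eq {n : Type*} [Fintype n] [DecidableEq n]
    {M : Matrix n n ℚ} {N : ℕ} (hN : N ≠ 0) (hM : M ^ (N + 1) = M) :
    IsIntegral ℤ M.trace := by
  let M' : Matrix n n ℂ := M.map (algebraMap ℚ ℂ)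
  have hM' : M' ^ (N + 1) = M' := by
    have := congrArg (fun A : Matrix n n ℚ => A.map (algebraMap ℚ ℂ)) hM
    simpa [Matrix.map_pow] using this
  have htr : algebraMap ℚ ℂ M.trace = M'.trace := by
    simp [M', Matrix.trace, map_sum]
  rw [← isIntegral_algebraMap_iff (algebraMap ℚ ℂ).injective, htr,
    Matrix.trace_eq_sum_roots_charpoly]
  refine IsIntegral.multiset_sum fun μ hμ => ?_
  have hroot : (Matrix.toLin' M').charpoly.IsRoot μ := by
    rw [Matrix.charpoly_toLin']
    exact (Polynomial.mem_roots'.mp hμ).2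
  rw [← Module.End.hasEigenvalue_iff_isRoot_charpoly] at hroot
  obtain ⟨v, hv⟩ := hroot.exists_hasEigenvector
  have h1 := hv.pow_apply (N + 1)
  rw [← Matrix.toLin'_pow, hM', hv.apply_eq_smul] at h1
  have h2 : μ = μ ^ (N + 1) := smul_left_injective ℂ hv.2 h1
  refine ⟨Polynomial.X ^ (N + 1) - Polynomial.X, ?_, ?_⟩
  · exact Polynomial.monic_X_pow_sub (by
      rw [Polynomial.degree_X]; exact_mod_cast Nat.lt_succ_of_le (Nat.one_le_iff_ne_zero.mpr hN))
  · simp [← h2]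

variable {Γ : Type*} [Group Γ] [Fintype Γ]

open MonoidAlgebra (single)

theorem trace_mulLeft (x : MonoidAlgebra ℚ Γ) :
    LinearMap.trace ℚ _ (LinearMap.mulLeft ℚ x) = Fintype.card Γ * x.coeff 1 := by
  classical
  rw [LinearMap.trace_eq_matrix_trace ℚ (MonoidAlgebra.basis Γ ℚ), Matrix.trace]
  have (g : Γ) : (LinearMap.toMatrix (MonoidAlgebra.basis Γ ℚ) (MonoidAlgebra.basis Γ ℚ)
      (LinearMap.mulLeft ℚ x)).diag g = x.coeff 1 := by
    rw [Matrix.diag_apply, LinearMap.toMatrix_apply]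
    simp [MonoidAlgebra.basis]
  rw [Finset.sum_congr rfl fun g _ => this g, Finset.sum_const, Finset.card_univ, nsmul_eq_mul]

/-- For `x = e g⁻¹` one has `x ^ (|Γ| + 1) = x`, since `e` is a central idempotent and `g ^ |Γ| =
1`. Left multiplication by `x` has trace `|Γ| e(g)`, which is therefore rational and integral. -/
theorem exists_int_eq_card_mul_coeff {e : MonoidAlgebra ℚ Γ} (he : IsIdempotentElem e)
    (hc : e ∈ Set.center (MonoidAlgebra ℚ Γ)) (g : Γ) :
    ∃ z : ℤ, (z : ℚ) = Fintype.card Γ * e.coeff g := by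
  classical
  let x := e * single g⁻¹ 1
  have hx : x ^ (Fintype.card Γ + 1) = x := by
    have hcom : Commute e (single g⁻¹ 1) := hc.comm _
    rw [hcom.mul_pow, he.pow_succ_eq, MonoidAlgebra.single_pow, one_pow, pow_succ, pow_card_eq_one,
      one_mul]
  let M := LinearMap.toMatrix (MonoidAlgebra.basis Γ ℚ) (MonoidAlgebra.basis Γ ℚ)
    (LinearMap.mulLeft ℚ x)
  have hM : M ^ (Fintype.card Γ + 1) = M := by
    dsimp only [M]
    rw [LinearMap.toMatrix_pow, LinearMap.pow_mulLeft, hx]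
  have h := isIntegral_trace_of_pow_succ_eq Fintype.card_ne_zero hM
  rw [← LinearMap.trace_eq_matrix_trace, trace_mulLeft] at h
  obtain ⟨z, hz⟩ := IsIntegrallyClosed.isIntegral_iff.mp h
  refine ⟨z, ?_⟩
  simpa [x] using hz

theorem ZS.toRat_injective (S : Set Nat.Primes) : Function.Injective (ZS.toRat S) := by
  refine (IsLocalization.lift_injective_iff _).mpr fun x y => ?_
  have hle : primeToS S ≤ nonZeroDivisors ℤ := fun n hn => mem_nonZeroDivisors_of_ne_zero hn.1
  rw [(IsLocalization.injective (ZS S) hle).eq_iff]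
  simp

theorem isUnit_natCast_ZS {S : Set Nat.Primes} {n : ℕ} (hn : n ≠ 0)
    (h : ∀ p ∈ S, ¬ (p : ℕ) ∣ n) : IsUnit (n : ZS S) := by
  have := IsLocalization.map_units (ZS S) (⟨(n : ℤ), by exact_mod_cast hn, fun p hp hd =>
    h p hp (by exact_mod_cast hd)⟩ : primeToS S)
  simpa using this

theorem mapRingHom_injective {R R' : Type*} [CommRing R] [CommRing R'] {f : R →+* R'}
    (hf : Function.Injective f) : Function.Injective (MonoidAlgebra.mapRingHom Γ f) := by
  intro x y h
  ext g
  exact hf (by simpa using congrArg (fun z => z.coeff g) h)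

/-- Central idempotents of `ℚ[Γ]` lie in `ℤ_S[Γ]` if no prime of `S` divides `|Γ|`. -/
theorem exists_mapRingHom_eq {S : Set Nat.Primes} (hS : ∀ p ∈ S, ¬ (p : ℕ) ∣ Fintype.card Γ)
    {e : MonoidAlgebra ℚ Γ} (he : IsIdempotentElem e)
    (hc : e ∈ Set.center (MonoidAlgebra ℚ Γ)) :
    ∃ r : MonoidAlgebra (ZS S) Γ, MonoidAlgebra.mapRingHom Γ (ZS.toRat S) r = e := by
  choose z hz using exists_int_eq_card_mul_coeff he hc
  obtain ⟨u, hu⟩ := isUnit_natCast_ZS Fintype.card_ne_zero hS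
  refine ⟨∑ g, single g (↑u⁻¹ * (z g : ZS S)), ?_⟩
  have hu' : ZS.toRat S ↑u⁻¹ = (Fintype.card Γ : ℚ)⁻¹ := by
    rw [← mul_eq_one_iff_eq_inv₀ (by simp), ← map_natCast (ZS.toRat S), ← map_mul, ← hu,
      Units.inv_mul, map_one]
  ext g
  classical
  simp [MonoidAlgebra.coeff_sum, hu', hz]

end Integrality

/-! ### Cardinalities of images of ring elements on modules -/

section Images

theorem card_map_eq_card_quotient {G X : Type*} [AddCommGroup G] [AddCommGroup X]
    (f : G →+ X) (K : AddSubgroup G) :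
    Nat.card (K.map f) = Nat.card (K ⧸ (f.comp K.subtype).ker) := by
  rw [Nat.card_congr (QuotientAddGroup.quotientKerEquivRange (f.comp K.subtype)).toEquiv,
    AddMonoidHom.range_comp, AddSubgroup.range_subtype]

theorem card_map_eq_of_ker_eq {G X Y : Type*} [AddCommGroup G] [AddCommGroup X] [AddCommGroup Y]
    (g : G →+ X) (h : G →+ Y) (hgh : ∀ b, g b = 0 ↔ h b = 0) (K : AddSubgroup G) :
    Nat.card (K.map g) = Nat.card (K.map h) := by
  have hker : (g.comp K.subtype).ker = (h.comp K.subtype).ker := by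
    ext b
    exact hgh b
  rw [card_map_eq_card_quotient, card_map_eq_card_quotient, hker]

variable {B : Type*} [Ring B]

/-- The image of multiplication by `a` on a module. -/
def imSub (a : B) (M : Type*) [AddCommGroup M] [Module B M] : AddSubgroup M :=
  (DistribSMul.toAddMonoidHom M a).range

variable {M : Type*} [AddCommGroup M] [Module B M]

theorem mem_imSub_iff_smul_eq {a : B} (ha : IsIdempotentElem a) {x : M} :
    x ∈ imSub a M ↔ a • x = x := by
  refine ⟨?_, fun h => ⟨x, h⟩⟩
  rintro ⟨y, rfl⟩
  change a • a • y = a • y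
  rw [smul_smul, ha.eq]

/-- Taking the image of an idempotent is exact: the kernel of `aM → a(M/N)` is `aM ∩ N`, which is
`aN` because `a` fixes `aM`. -/
theorem card_imSub_eq_mul [Finite M] (N : Submodule B M) {a : B} (ha : IsIdempotentElem a) :
    Nat.card (imSub a M) = Nat.card (imSub a N) * Nat.card (imSub a (M ⧸ N)) := by
  let q : imSub a M →+ M ⧸ N := N.mkQ.toAddMonoidHom.comp (imSub a M).subtype
  have h1 : q.range = imSub a (M ⧸ N) := by
    ext y
    constructor
    · rintro ⟨⟨_, x, rfl⟩, rfl⟩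
      exact ⟨N.mkQ x, (map_smul N.mkQ a x).symm⟩
    · rintro ⟨z, rfl⟩
      obtain ⟨x, rfl⟩ := N.mkQ_surjective z
      exact ⟨⟨a • x, x, rfl⟩, map_smul N.mkQ a x⟩
  have h2 : Nat.card q.ker = Nat.card (imSub a N) := by
    refine Nat.card_congr
      { toFun := fun x => ⟨⟨x.1.1, ?_⟩, ?_⟩
        invFun := fun x => ⟨⟨x.1.1, ?_⟩, ?_⟩
        left_inv := fun x => rfl
        right_inv := fun x => rfl }
    · exact (Submodule.Quotient.mk_eq_zero N).mp x.2
    · exact (mem_imSub_iff_smul_eq ha).mpr (Subtype.ext ((mem_imSub_iff_smul_eq ha).mp x.1.2))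
    · exact (mem_imSub_iff_smul_eq ha).mpr
        (congrArg Subtype.val ((mem_imSub_iff_smul_eq ha).mp x.2))
    · exact (Submodule.Quotient.mk_eq_zero N).mpr x.1.2
  rw [← h1, ← h2, AddSubgroup.card_eq_card_quotient_mul_card_addSubgroup q.ker, mul_comm,
    Nat.card_congr (QuotientAddGroup.quotientKerEquivRange q).toEquiv]

end Images

/-! ### Traces of idempotents over a local ring -/

section LocalTrace

variable {R M : Type*} [CommRing R] [IsLocalRing R] [AddCommGroup M] [Module R M]
  [Module.Free R M] [Module.Finite R M]

theorem free_range_of_isIdempotentElem {E : Module.End R M} (hE : IsIdempotentElem E) :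
    Module.Free R (LinearMap.range E) := by
  have : Module.Projective R (LinearMap.range E) := by
    refine Module.Projective.of_split (LinearMap.range E).subtype E.rangeRestrict ?_
    ext ⟨_, x, rfl⟩
    exact congrArg (fun f : Module.End R M => f x) hE.eq
  exact Module.free_of_flat_of_isLocalRing

theorem ker_eq_range_one_sub {R M : Type*} [CommRing R] [AddCommGroup M] [Module R M]
    {E : Module.End R M} (hE : IsIdempotentElem E) :
    LinearMap.ker E = LinearMap.range (1 - E) := by
  ext x
  constructor
  · intro hx
    exact ⟨x, by simp [LinearMap.mem_ker.mp hx]⟩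
  · rintro ⟨y, rfl⟩
    have := congrArg (fun f : Module.End R M => f y) hE.eq
    simpa [sub_eq_zero] using this.symm

variable {F M' : Type*} [Field F] {π : R →+* F} [AddCommGroup M'] [Module F M']

/-- The reduction of a basis of the range of `E` spans the range of `E'`. -/
theorem finrank_range_le_finrank_range {q : M →ₛₗ[π] M'} (hq : Function.Surjective q)
    {E : Module.End R M} {E' : Module.End F M'} (hE : IsIdempotentElem E)
    (h : ∀ x, q (E x) = E' (q x)) :
    Module.finrank F (LinearMap.range E') ≤ Module.finrank R (LinearMap.range E) := by
  have := free_range_of_isIdempotentElem hE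
  let b := Module.finBasis R (LinearMap.range E)
  have hs : LinearMap.range E' ≤ Submodule.span F (Set.range fun i => q (b i).1) := by
    rintro _ ⟨y, rfl⟩
    obtain ⟨x, rfl⟩ := hq y
    rw [← h]
    have hx : E x = ∑ i, b.repr (E.rangeRestrict x) i • (b i).1 :=
      (congrArg Subtype.val (b.sum_repr (E.rangeRestrict x))).symm.trans
        (map_sum (LinearMap.range E).subtype _ _)
    rw [hx, map_sum]
    refine Submodule.sum_mem _ fun i _ => ?_
    rw [map_smulₛₗ]
    exact Submodule.smul_mem _ _ (Submodule.subset_span ⟨i, rfl⟩)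
  have hf := FiniteDimensional.span_of_finite F (Set.finite_range fun i => q (b i).1)
  exact (Submodule.finrank_mono hs).trans ((finrank_range_le_card _).trans_eq (by simp))

/-- The trace of an idempotent endomorphism of a free module over a local ring is the dimension
of the range of its reduction. -/
theorem trace_eq_finrank_range [FiniteDimensional F M'] {q : M →ₛₗ[π] M'}
    (hq : Function.Surjective q) (hr : Module.finrank F M' = Module.finrank R M)
    {E : Module.End R M} {E' : Module.End F M'} (hE : IsIdempotentElem E)
    (h : ∀ x, q (E x) = E' (q x)) :
    LinearMap.trace R M E = Module.finrank F (LinearMap.range E') := by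
  have hE' : IsIdempotentElem E' := by
    refine LinearMap.ext fun y => ?_
    obtain ⟨x, rfl⟩ := hq y
    have := congrArg (fun f : Module.End R M => q (f x)) hE.eq
    simpa [h] using this
  have h1 := finrank_range_le_finrank_range hq hE h
  -- The inequality for `1 - E` bounds the complementary ranks; since both pairs add up to the same
  -- total, both inequalities are equalities.
  have h2 := finrank_range_le_finrank_range (E := 1 - E) (E' := 1 - E') hq hE.one_sub
    (fun x => by simp [h])
  have hf1 := free_range_of_isIdempotentElem hE
  have hf2 := free_range_of_isIdempotentElem hE.one_sub
  rw [← ker_eq_range_one_sub hE] at h2 hf2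
  rw [← ker_eq_range_one_sub hE'] at h2
  have hfin : Module.Finite R (LinearMap.ker E) := by
    rw [ker_eq_range_one_sub hE]; infer_instance
  have h3 := LinearMap.finrank_range_add_finrank_ker E'
  have h4 : Module.finrank R (LinearMap.range E) + Module.finrank R (LinearMap.ker E) =
      Module.finrank R M := by
    rw [← Module.finrank_prod]
    exact (Submodule.prodEquivOfIsCompl _ _
      (LinearMap.IsIdempotentElem.isProj_range _ hE).isCompl).finrank_eq
  rw [(LinearMap.IsIdempotentElem.isProj_range _ hE).trace]
  congr 1
  omega

end LocalTrace

/-! ### Group rings over ℤ/p^(k+1) and ranks of two-sided multiplications -/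

section ReductionModP

variable {Γ : Type*} [Group Γ] [Fintype Γ] (p : ℕ) [hp : Fact p.Prime]

open MonoidAlgebra (single)

/-- Reduction from `ℤ/p^(k+1)` to `ℤ/p`. -/
def redZMod (k : ℕ) : ZMod (p ^ (k + 1)) →+* ZMod p :=
  ZMod.castHom (dvd_pow_self p k.succ_ne_zero) (ZMod p)

theorem isUnit_of_redZMod_ne_zero {k : ℕ} {x : ZMod (p ^ (k + 1))} (hx : redZMod p k x ≠ 0) :
    IsUnit x := by
  obtain ⟨z, rfl⟩ := ZMod.natCast_zmod_surjective x
  rw [map_natCast, Ne, ZMod.natCast_eq_zero_iff] at hx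
  rw [ZMod.isUnit_iff_coprime]
  exact ((hp.out.coprime_iff_not_dvd.mpr hx).pow_left _).symm

instance isLocalRing_zmod_prime_pow (k : ℕ) : IsLocalRing (ZMod (p ^ (k + 1))) := by
  have : Nontrivial (ZMod (p ^ (k + 1))) :=
    ZMod.nontrivial_iff.mpr (Nat.one_lt_pow k.succ_ne_zero hp.out.one_lt).ne'
  refine IsLocalRing.of_isUnit_or_isUnit_one_sub_self fun x => ?_
  by_cases hx : redZMod p k x = 0
  · exact Or.inr (isUnit_of_redZMod_ne_zero p (by simp [hx]))
  · exact Or.inl (isUnit_of_redZMod_ne_zero p hx)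

theorem exists_eq_mul_of_redZMod_eq_zero {k : ℕ} {x : ZMod (p ^ (k + 1))} (hx : redZMod p k x = 0) :
    ∃ y, x = p * y := by
  obtain ⟨z, rfl⟩ := ZMod.intCast_surjective x
  rw [map_intCast, ZMod.intCast_zmod_eq_zero_iff_dvd] at hx
  obtain ⟨y, rfl⟩ := hx
  exact ⟨y, by push_cast; rfl⟩

theorem exists_eq_nsmul {R R' : Type*} [CommRing R] [CommRing R'] {f : R →+* R'} {n : ℕ}
    (hf : ∀ x, f x = 0 → ∃ y, x = n * y) {x : MonoidAlgebra R Γ}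
    (hx : MonoidAlgebra.mapRingHom Γ f x = 0) : ∃ y, x = n • y := by
  have h (g : Γ) : ∃ y, x.coeff g = n * y :=
    hf _ (by simpa using congrArg (fun z => z.coeff g) hx)
  choose y hy using h
  refine ⟨∑ g, single g (y g), ?_⟩
  ext g
  classical
  rw [hy, MonoidAlgebra.coeff_smul_apply, nsmul_eq_mul]
  simp [MonoidAlgebra.coeff_sum, Finsupp.single_apply]

theorem mapRingHom_surjective {R R' : Type*} [CommRing R] [CommRing R'] {f : R →+* R'}
    (hf : Function.Surjective f) : Function.Surjective (MonoidAlgebra.mapRingHom Γ f) := by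
  intro x
  choose y hy using fun g => hf (x.coeff g)
  refine ⟨∑ g, single g (y g), ?_⟩
  ext g
  classical
  simp [MonoidAlgebra.coeff_sum, hy]

theorem redZMod_surjective (k : ℕ) : Function.Surjective (redZMod p k) :=
  ZMod.castHom_surjective _

/-- The kernel of reduction consists of multiples of `p`, so it is nil and idempotents lift. -/
theorem exists_lift_idempotent (k : ℕ) {f : MonoidAlgebra (ZMod p) Γ} (hf : IsIdempotentElem f) :
    ∃ f' : MonoidAlgebra (ZMod (p ^ (k + 1))) Γ, IsIdempotentElem f' ∧
      MonoidAlgebra.mapRingHom Γ (redZMod p k) f' = f := by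
  refine exists_isIdempotentElem_eq_of_ker_isNilpotent _ (fun x hx => ⟨k + 1, ?_⟩) f
    (mapRingHom_surjective (redZMod_surjective p k) f) hf
  obtain ⟨y, rfl⟩ := exists_eq_nsmul
    (fun x hx => exists_eq_mul_of_redZMod_eq_zero p hx) (RingHom.mem_ker.mp hx)
  rw [smul_pow, ← Nat.cast_smul_eq_nsmul (ZMod (p ^ (k + 1))), ZMod.natCast_self, zero_smul]

/-- The rank of `x ↦ a x f` on a group algebra. -/
def twoSidedRank {F : Type*} [Field F] (a f : MonoidAlgebra F Γ) : ℕ :=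
  Module.finrank F (LinearMap.range (LinearMap.mulLeft F a * LinearMap.mulRight F f))

/-- The trace of `x ↦ a x f` on a group ring. -/
def twoSidedTrace {R : Type*} [CommRing R] (f : MonoidAlgebra R Γ) : MonoidAlgebra R Γ →+ R where
  toFun a := LinearMap.trace R _ (LinearMap.mulLeft R a * LinearMap.mulRight R f)
  map_zero' := by simp
  map_add' a b := by
    rw [← map_add, ← add_mul]
    congr 2
    ext; simp [add_mul]

theorem twoSidedTrace_mul_comm {R : Type*} [CommRing R] (f a b : MonoidAlgebra R Γ) :
    twoSidedTrace f (a * b) = twoSidedTrace f (b * a) := by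
  change LinearMap.trace R _ _ = LinearMap.trace R _ _
  have hL (a b : MonoidAlgebra R Γ) :
      LinearMap.mulLeft R (a * b) = LinearMap.mulLeft R a * LinearMap.mulLeft R b :=
    LinearMap.mulLeft_mul R _ a b
  have hc : Commute (LinearMap.mulLeft R b) (LinearMap.mulRight R f) :=
    LinearMap.commute_mulLeft_right b f
  rw [hL, hL, mul_assoc, hc.eq, ← mul_assoc, LinearMap.trace_mul_comm, mul_assoc]

theorem twoSidedTrace_eq_twoSidedRank (k : ℕ) {a f : MonoidAlgebra (ZMod (p ^ (k + 1))) Γ}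
    (ha : IsIdempotentElem a) (hf : IsIdempotentElem f) :
    twoSidedTrace f a = twoSidedRank (MonoidAlgebra.mapRingHom Γ (redZMod p k) a)
      (MonoidAlgebra.mapRingHom Γ (redZMod p k) f) := by
  let q : MonoidAlgebra (ZMod (p ^ (k + 1))) Γ →ₛₗ[redZMod p k] MonoidAlgebra (ZMod p) Γ :=
    { MonoidAlgebra.mapRingHom Γ (redZMod p k) with
      map_smul' := fun c x => by ext g; simp }
  refine trace_eq_finrank_range (q := q) (mapRingHom_surjective (redZMod_surjective p k)) ?_ ?_ ?_
  · rw [Module.finrank_eq_card_basis (MonoidAlgebra.basis Γ (ZMod p)),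
      Module.finrank_eq_card_basis (MonoidAlgebra.basis Γ (ZMod (p ^ (k + 1))))]
  · refine LinearMap.ext fun x => ?_
    simp only [Module.End.mul_apply, LinearMap.mulLeft_apply, LinearMap.mulRight_apply]
    rw [mul_assoc, mul_assoc, hf.eq, ← mul_assoc a a, ha.eq]
  · intro x
    simp [q]

end ReductionModP

/-! ### Reduction of ℤ_S[Γ] at primes of S -/

section ModPReductionZS

variable {Γ : Type*} [Group Γ] [Fintype Γ] {S : Set Nat.Primes}

open MonoidAlgebra (single)

/-- The reduction `ℤ_S → ℤ/p^(k+1)` for `p ∈ S`. -/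
def ZS.toZMod {p : Nat.Primes} (hp : p ∈ S) (k : ℕ) : ZS S →+* ZMod ((p : ℕ) ^ (k + 1)) :=
  IsLocalization.lift (M := primeToS S) (g := Int.castRingHom _) fun y => by
    have hc : IsCoprime (y : ℤ) (((p : ℕ) : ℤ) ^ (k + 1)) :=
      ((Nat.prime_iff_prime_int.mp p.2).coprime_iff_not_dvd.mpr (y.2.2 p hp)).symm.pow_right
    obtain ⟨a, b, hab⟩ := hc
    refine .of_mul_eq_one (a : ZMod _) ?_
    have h := congrArg (Int.cast : ℤ → ZMod ((p : ℕ) ^ (k + 1))) hab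
    have h0 : ((p : ℕ) : ZMod ((p : ℕ) ^ (k + 1))) ^ (k + 1) = 0 := by
      exact_mod_cast ZMod.natCast_self ((p : ℕ) ^ (k + 1))
    push_cast at h
    rw [h0, mul_zero, add_zero] at h
    rw [mul_comm]
    simpa using h

variable {p : Nat.Primes} (hp : p ∈ S)

/-- The reduction `ℤ_S → ℤ/p` for `p ∈ S`. -/
def ZS.toZModPrime : ZS S →+* ZMod (p : ℕ) :=
  haveI := Fact.mk p.2
  (redZMod p 0).comp (ZS.toZMod hp 0)

theorem redZMod_comp_toZMod [Fact (p : ℕ).Prime] (k : ℕ) :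
    (redZMod p k).comp (ZS.toZMod hp k) = ZS.toZModPrime hp :=
  IsLocalization.ringHom_ext (primeToS S) (RingHom.ext_int _ _)

theorem ZS.toZModPrime_surjective : Function.Surjective (ZS.toZModPrime hp) := by
  intro x
  obtain ⟨z, rfl⟩ := ZMod.intCast_surjective x
  exact ⟨z, map_intCast _ z⟩

theorem ZS.exists_eq_mul_of_toZModPrime_eq_zero {x : ZS S} (hx : ZS.toZModPrime hp x = 0) :
    ∃ y, x = ((p : ℕ) : ZS S) * y := by
  obtain ⟨a, s, rfl⟩ := IsLocalization.exists_mk'_eq (primeToS S) x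
  have h := congrArg (ZS.toZModPrime hp) (IsLocalization.mk'_spec (ZS S) a s)
  rw [map_mul, hx, zero_mul, eq_comm] at h
  have h' : ((a : ℤ) : ZMod (p : ℕ)) = 0 := by
    simpa using h
  rw [ZMod.intCast_zmod_eq_zero_iff_dvd] at h'
  obtain ⟨b, rfl⟩ := h'
  refine ⟨IsLocalization.mk' _ b s, ?_⟩
  rw [← IsLocalization.mul_mk'_eq_mk'_of_mul]
  simp

/-- A cyclic `ℤ_S[Γ]`-module killed by `p ∈ S` is the reduction modulo `p` of a projective module;
this computes the cardinalities of the images of elements of `ℤ_S[Γ]`. -/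
theorem exists_card_imSub_eq_pow {M : Type*} [AddCommGroup M]
    [Module (MonoidAlgebra (ZS S) Γ) M] {m : M}
    (hΓ : NeZero (Nat.card Γ : ZMod (p : ℕ))) (hm : ∀ x : M, ∃ b : MonoidAlgebra (ZS S) Γ, b • m = x) (hpM : ∀ x : M, (p : ℕ) • x = 0) :
    haveI := Fact.mk p.2
    ∃ f : MonoidAlgebra (ZMod (p : ℕ)) Γ, IsIdempotentElem f ∧ ∀ a : MonoidAlgebra (ZS S) Γ,
      Nat.card (imSub a M) =
        (p : ℕ) ^ twoSidedRank (MonoidAlgebra.mapRingHom Γ (ZS.toZModPrime hp) a) f := by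
  have := Fact.mk p.2
  have : NeZero (Nat.card Γ : ZMod (p : ℕ)) := hΓ
  let π := MonoidAlgebra.mapRingHom Γ (ZS.toZModPrime hp)
  have hπ : Function.Surjective π := mapRingHom_surjective (ZS.toZModPrime_surjective hp)
  have hker {b : MonoidAlgebra (ZS S) Γ} (hb : π b = 0) : b • m = 0 := by
    obtain ⟨y, rfl⟩ := exists_eq_nsmul
      (fun x hx => ZS.exists_eq_mul_of_toZModPrime_eq_zero hp hx) hb
    rw [smul_assoc, hpM]
  let I : Ideal (MonoidAlgebra (ZS S) Γ) := LinearMap.ker (LinearMap.toSpanSingleton _ M m)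
  -- By Maschke the reduced annihilator of `m` is generated by an idempotent `e`, so `M` is
  -- `𝔽_p[Γ](1 - e)` and the required `f` is `1 - e`.
  obtain ⟨e, he, heI⟩ := IsSemisimpleRing.ideal_eq_span_idempotent (I.map π)
  refine ⟨1 - e, he.one_sub, fun a => ?_⟩
  let g : MonoidAlgebra (ZS S) Γ →+ M := (LinearMap.toSpanSingleton _ M m).toAddMonoidHom
  let h : MonoidAlgebra (ZS S) Γ →+ MonoidAlgebra (ZMod (p : ℕ)) Γ :=
    (AddMonoidHom.mulRight (1 - e)).comp π.toAddMonoidHom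
  have hgh (b) : g b = 0 ↔ h b = 0 := by
    change b • m = 0 ↔ π b * (1 - e) = 0
    have h1 : π b * (1 - e) = 0 ↔ π b ∈ I.map π := by
      rw [heI, Ideal.mem_span_singleton', mul_sub, mul_one, sub_eq_zero]
      refine ⟨fun h => ⟨_, h.symm⟩, ?_⟩
      rintro ⟨y, hy⟩
      rw [← hy, mul_assoc, he.eq]
    rw [h1, Ideal.mem_map_iff_of_surjective π hπ]
    constructor
    · exact fun hb => ⟨b, hb, rfl⟩
    · rintro ⟨b', hb', hbb⟩
      have h2 := hker (b := b - b') (by rw [map_sub, hbb, sub_self])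
      rw [sub_smul, show b' • m = 0 from hb', sub_zero] at h2
      exact h2
  let K : AddSubgroup (MonoidAlgebra (ZS S) Γ) := (AddMonoidHom.mulLeft a).range
  have hg : K.map g = imSub a M := by
    ext x
    constructor
    · rintro ⟨_, ⟨b, rfl⟩, rfl⟩
      exact ⟨b • m, (mul_smul a b m).symm⟩
    · rintro ⟨y, rfl⟩
      obtain ⟨b, rfl⟩ := hm y
      exact ⟨a * b, ⟨b, rfl⟩, mul_smul a b m⟩
  have hh : K.map h = (LinearMap.range (LinearMap.mulLeft (ZMod (p : ℕ)) (π a) *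
      LinearMap.mulRight (ZMod (p : ℕ)) (1 - e))).toAddSubgroup := by
    ext x
    constructor
    · rintro ⟨_, ⟨b, rfl⟩, rfl⟩
      refine ⟨π b, ?_⟩
      change π a * (π b * (1 - e)) = π (a * b) * (1 - e)
      rw [map_mul, mul_assoc]
    · rintro ⟨y, rfl⟩
      obtain ⟨b, rfl⟩ := hπ y
      refine ⟨a * b, ⟨b, rfl⟩, ?_⟩
      change π (a * b) * (1 - e) = π a * (π b * (1 - e))
      rw [map_mul, mul_assoc]
  rw [← hg, card_map_eq_of_ker_eq g h hgh, hh]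
  have hcard := Module.natCard_eq_pow_finrank (K := ZMod (p : ℕ))
    (V := LinearMap.range (LinearMap.mulLeft (ZMod (p : ℕ)) (π a) *
      LinearMap.mulRight (ZMod (p : ℕ)) (1 - e)))
  rw [Nat.card_zmod] at hcard
  exact hcard

/-- Applying the trace of `x ↦ a x f'`, with `f'` a lift of `f`, to the relation `h` gives the
equality modulo every `p^(k+1)`; the common factor `|Γ|` then cancels in `ℕ`. -/
theorem mul_twoSidedRank_eq [Fact (p : ℕ).Prime] {a c : MonoidAlgebra (ZS S) Γ}
    (ha : IsIdempotentElem a) (hc : IsIdempotentElem c) {n r : ℕ}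
    (h : n • sumConj c = (r * Fintype.card Γ) • a) {f : MonoidAlgebra (ZMod (p : ℕ)) Γ}
    (hf : IsIdempotentElem f) :
    n * twoSidedRank (MonoidAlgebra.mapRingHom Γ (ZS.toZModPrime hp) c) f =
      r * twoSidedRank (MonoidAlgebra.mapRingHom Γ (ZS.toZModPrime hp) a) f := by
  set dc := twoSidedRank (MonoidAlgebra.mapRingHom Γ (ZS.toZModPrime hp) c) f
  set da := twoSidedRank (MonoidAlgebra.mapRingHom Γ (ZS.toZModPrime hp) a) f
  have key (k : ℕ) : ((n * (Fintype.card Γ * dc) : ℕ) : ZMod ((p : ℕ) ^ (k + 1))) =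
      ((r * Fintype.card Γ * da : ℕ) : ZMod ((p : ℕ) ^ (k + 1))) := by
    obtain ⟨f', hf', hff'⟩ := exists_lift_idempotent (Γ := Γ) (p : ℕ) k hf
    let P := MonoidAlgebra.mapRingHom Γ (ZS.toZMod hp k)
    have hP (x : MonoidAlgebra (ZS S) Γ) : MonoidAlgebra.mapRingHom Γ (redZMod p k) (P x) =
        MonoidAlgebra.mapRingHom Γ (ZS.toZModPrime hp) x := by
      rw [← redZMod_comp_toZMod hp k]
      ext g
      simp [P]
    have hT {x : MonoidAlgebra (ZS S) Γ} (hx : IsIdempotentElem x) : twoSidedTrace f' (P x) =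
        twoSidedRank (MonoidAlgebra.mapRingHom Γ (ZS.toZModPrime hp) x) f := by
      rw [twoSidedTrace_eq_twoSidedRank p k (hx.map P) hf', hP, hff']
    have h1 := congrArg (fun x => twoSidedTrace f' (P x)) h
    simp only [map_nsmul] at h1
    rw [hT ha, map_sumConj, card_smul_eq_sumConj _ (twoSidedTrace_mul_comm f'), hT hc] at h1
    simpa [nsmul_eq_mul] using h1
  set A := n * (Fintype.card Γ * dc)
  set B := r * Fintype.card Γ * da
  have hAB : A = B := by
    -- With `k = A + B` the modulus exceeds both sides, so the congruence is an equality.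
    have hlt : A + B < (p : ℕ) ^ (A + B + 1) :=
      (Nat.lt_succ_self _).trans (Nat.lt_pow_self p.2.one_lt)
    have := (ZMod.natCast_eq_natCast_iff' _ _ _).mp (key (A + B))
    rwa [Nat.mod_eq_of_lt (by omega), Nat.mod_eq_of_lt (by omega)] at this
  refine Nat.eq_of_mul_eq_mul_left (Fintype.card_pos (α := Γ)) ?_
  calc _ = A := by ring
    _ = B := hAB
    _ = _ := by ring

end ModPReductionZS

/-- Dévissage: both sides are multiplicative along `N ⊆ M`, with `N` generated by an element of
prime order `p`; on `N` the claim is an equality of ranks over `𝔽_p`. -/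
theorem card_imSub_pow_eq {Γ : Type*} [Group Γ] [Fintype Γ] {S : Set Nat.Primes}
    (hS : ∀ p ∈ S, ¬ (p : ℕ) ∣ Fintype.card Γ) {a c : MonoidAlgebra (ZS S) Γ}
    (ha : IsIdempotentElem a) (hc : IsIdempotentElem c) {n r : ℕ}
    (h : n • sumConj c = (r * Fintype.card Γ) • a) (M : Type*) [AddCommGroup M]
    [Module (MonoidAlgebra (ZS S) Γ) M] [Finite M] :
    Nat.card (imSub c M) ^ n = Nat.card (imSub a M) ^ r := by
  induction hN : Nat.card M using Nat.strong_induction_on generalizing M with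
  | _ N ih =>
    subst hN
    rcases subsingleton_or_nontrivial M with hM | hM
    · rw [Nat.card_unique, Nat.card_unique, one_pow, one_pow]
    obtain ⟨p, hp, hpd⟩ := Nat.exists_prime_and_dvd (Finite.one_lt_card (α := M)).ne'
    have := Fact.mk hp
    obtain ⟨x, hx⟩ := exists_prime_addOrderOf_dvd_card' p hpd
    have hx0 : x ≠ 0 := by
      rintro rfl
      rw [addOrderOf_zero] at hx
      exact hp.one_lt.ne hx
    have hpx : p • x = 0 := hx ▸ addOrderOf_nsmul_eq_zero x
    -- A prime outside `S` is a unit in `ℤ_S`, so it kills no nonzero element.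
    have hpS : (⟨p, hp⟩ : Nat.Primes) ∈ S := by
      by_contra hpS
      have hu : IsUnit (p : ZS S) := isUnit_natCast_ZS hp.ne_zero fun q hq hd =>
        hpS (by rwa [show (⟨p, hp⟩ : Nat.Primes) = q from
          Subtype.ext ((Nat.prime_dvd_prime_iff_eq q.2 hp).mp hd).symm])
      have hu' : IsUnit (p : MonoidAlgebra (ZS S) Γ) := by
        simpa using hu.map (algebraMap (ZS S) (MonoidAlgebra (ZS S) Γ))
      rw [← Nat.cast_smul_eq_nsmul (MonoidAlgebra (ZS S) Γ)] at hpx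
      exact hx0 (hu'.smul_eq_zero.mp hpx)
    let N := Submodule.span (MonoidAlgebra (ZS S) Γ) {x}
    have hxN : x ∈ N := Submodule.mem_span_singleton_self x
    have hgen (y : N) : ∃ b : MonoidAlgebra (ZS S) Γ, b • (⟨x, hxN⟩ : N) = y := by
      obtain ⟨b, hb⟩ := Submodule.mem_span_singleton.mp y.2
      exact ⟨b, Subtype.ext hb⟩
    have hpN (y : N) : p • y = 0 := by
      obtain ⟨b, rfl⟩ := hgen y
      rw [smul_comm p b, show p • (⟨x, hxN⟩ : N) = 0 from Subtype.ext hpx, smul_zero]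
    obtain ⟨f, hf, hcard⟩ := exists_card_imSub_eq_pow (Γ := Γ) (M := N) hpS ⟨by
      rw [Nat.card_eq_fintype_card, Ne, ZMod.natCast_eq_zero_iff]
      exact hS _ hpS⟩ hgen hpN
    have : Finite (M ⧸ N) := Finite.of_surjective N.mkQ N.mkQ_surjective
    have hlt : Nat.card (M ⧸ N) < Nat.card M := by
      rw [Submodule.card_eq_card_quotient_mul_card N]
      have : Nontrivial N := ⟨⟨⟨x, hxN⟩, 0, fun h => hx0 (congrArg Subtype.val h)⟩⟩
      exact lt_mul_of_one_lt_left (Nat.card_pos (α := M ⧸ N)) (Finite.one_lt_card (α := N))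
    rw [card_imSub_eq_mul N ha, card_imSub_eq_mul N hc, mul_pow, mul_pow, ih _ hlt (M ⧸ N) rfl,
      hcard, hcard, ← pow_mul, ← pow_mul, mul_comm _ n, mul_comm _ r,
      mul_twoSidedRank_eq hpS ha hc h hf]

/-- The `c i` commute with `a`, so they split `aM` into the direct sum of the `c i a M`. -/
theorem card_imSub_eq_prod {B : Type*} [Ring B] {M : Type*} [AddCommGroup M] [Module B M]
    {ι : Type*} [Fintype ι] {c : ι → B} (hc : OrthogonalIdempotents c)
    (hM : ∀ x : M, (∑ i, c i) • x = x) {a : B} (hca : ∀ i, Commute (c i) a) :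
    Nat.card (imSub a M) = ∏ i, Nat.card (imSub (c i * a) M) := by
  classical
  rw [← Nat.card_pi]
  have hci {i j : ι} {y : M} (hy : y ∈ imSub (c j * a) M) :
      c i • y = if i = j then y else 0 := by
    obtain ⟨z, rfl⟩ := hy
    change c i • (c j * a) • z = if i = j then (c j * a) • z else 0
    rw [smul_smul, ← mul_assoc, hc.mul_eq]
    split_ifs with h
    · rw [h]
    · rw [zero_mul, zero_smul]
  refine Nat.card_congr
    { toFun := fun x i => ⟨c i • x.1, ?_⟩
      invFun := fun y => ⟨∑ i, (y i).1, ?_⟩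
      left_inv := fun x => Subtype.ext ?_
      right_inv := fun y => funext fun i => Subtype.ext ?_ }
  · obtain ⟨_, z, rfl⟩ := x
    exact ⟨z, mul_smul _ _ _⟩
  · refine AddSubgroup.sum_mem _ fun i _ => ?_
    obtain ⟨z, hz⟩ := (y i).2
    refine ⟨c i • z, ?_⟩
    rw [← hz]
    change a • c i • z = (c i * a) • z
    rw [smul_smul, (hca i).eq]
  · change ∑ i, c i • x.1 = x.1
    rw [← Finset.sum_smul, hM]
  · change c i • ∑ j, (y j).1 = (y i).1
    rw [Finset.smul_sum, Finset.sum_congr rfl fun j _ => hci (y j).2]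
    simp

/-! ### Idempotent parts and fixed points of modules over the reduced ring -/

section Reduced

variable {Γ : Type*} [Group Γ] [Fintype Γ] {S : Set Nat.Primes}
  (hS : ∀ p ∈ S, ¬ (p : ℕ) ∣ Fintype.card Γ)

open MonoidAlgebra (single)

/-- The embedding `ℤ_S[Γ] → ℚ[Γ]`. -/
abbrev toRatAlg (Γ : Type*) [Group Γ] [Fintype Γ] (S : Set Nat.Primes) :
    MonoidAlgebra (ZS S) Γ →+* MonoidAlgebra ℚ Γ :=
  MonoidAlgebra.mapRingHom Γ (ZS.toRat S)

theorem toRatAlg_injective : Function.Injective (toRatAlg Γ S) :=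
  mapRingHom_injective (ZS.toRat_injective S)

include hS in
theorem isUnit_card_subgroup (Δ : Subgroup Γ) : IsUnit (Nat.card Δ : ZS S) := by
  refine isUnit_natCast_ZS Nat.card_pos.ne' fun p hp hd => hS p hp (hd.trans ?_)
  rw [← Nat.card_eq_fintype_card]
  exact Subgroup.card_subgroup_dvd_card Δ

include hS in
theorem toRatAlg_e₁ : toRatAlg Γ S (e₁ Γ (ZS S)) = e₁ Γ ℚ := by
  have hu := isUnit_natCast_ZS Fintype.card_ne_zero hS
  have h : ZS.toRat S (Ring.inverse (Fintype.card Γ : ZS S)) =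
      Ring.inverse (Fintype.card Γ : ℚ) := by
    rw [Ring.inverse_eq_inv', ← mul_eq_one_iff_eq_inv₀ (by simp), ← map_natCast (ZS.toRat S),
      ← map_mul, Ring.inverse_mul_cancel _ hu, map_one]
  ext g
  classical
  simp [e₁, MonoidAlgebra.coeff_smul, MonoidAlgebra.coeff_sum, h, Finsupp.single_apply]

/-- The element of `ℤ_S[Γ]` that is equal to a given central idempotent of `ℚ[Γ]`. -/
def intIdem {e : MonoidAlgebra ℚ Γ} (he : IsIrredCentralIdem e) : MonoidAlgebra (ZS S) Γ :=
  (exists_mapRingHom_eq hS he.idem he.central).choose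

theorem toRatAlg_intIdem {e : MonoidAlgebra ℚ Γ} (he : IsIrredCentralIdem e) :
    toRatAlg Γ S (intIdem hS he) = e :=
  (exists_mapRingHom_eq hS he.idem he.central).choose_spec

theorem isIdempotentElem_intIdem {e : MonoidAlgebra ℚ Γ} (he : IsIrredCentralIdem e) :
    IsIdempotentElem (intIdem hS he) :=
  toRatAlg_injective (by rw [map_mul, toRatAlg_intIdem, he.idem.eq])

theorem commute_intIdem {e : MonoidAlgebra ℚ Γ} (he : IsIrredCentralIdem e)
    (x : MonoidAlgebra (ZS S) Γ) : Commute (intIdem hS he) x :=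
  toRatAlg_injective (by rw [map_mul, map_mul, toRatAlg_intIdem, (he.central.comm _).eq])

theorem isIdempotentElem_intIdem_mul_subIdem {e : MonoidAlgebra ℚ Γ} (he : IsIrredCentralIdem e)
    (Δ : Subgroup Γ) : IsIdempotentElem (intIdem hS he * subIdem (ZS S) Δ) :=
  (isIdempotentElem_intIdem hS he).mul_of_commute (commute_intIdem hS he _)
    (isIdempotentElem_subIdem (isUnit_card_subgroup hS Δ))

theorem sumConj_intIdem_mul_subIdem {e : MonoidAlgebra ℚ Γ} (he : IsIrredCentralIdem e)
    (Δ : Subgroup Γ) {V : Type*} [AddCommGroup V] [Module ℂ V] [FiniteDimensional ℂ V]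
    (ρ : Representation ℂ Γ V) [ρ.IsIrreducible] (h1 : ratHom ρ e = 1) {r : ℕ}
    (hr : ratTrace ρ (subIdem ℚ Δ) = r) :
    Module.finrank ℂ V • sumConj (intIdem hS he * subIdem (ZS S) Δ) =
      (r * Fintype.card Γ) • intIdem hS he := by
  refine toRatAlg_injective ?_
  rw [map_nsmul, map_nsmul, map_sumConj, map_mul, toRatAlg_intIdem,
    map_subIdem _ (isUnit_card_subgroup hS Δ), sumConj_mul_eq ρ he h1 hr]

variable (H : Type*) [AddCommGroup H] [Module (ReducedRing Γ S) H]

include hS in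
theorem card_imSub_toReduced_pow_eq [Finite H] {a c : MonoidAlgebra (ZS S) Γ}
    (ha : IsIdempotentElem a) (hc : IsIdempotentElem c) {n r : ℕ}
    (h : n • sumConj c = (r * Fintype.card Γ) • a) :
    Nat.card (imSub (toReduced Γ S c) H) ^ n = Nat.card (imSub (toReduced Γ S a) H) ^ r :=
  let _ : Module (MonoidAlgebra (ZS S) Γ) H := Module.compHom H (toReduced Γ S)
  card_imSub_pow_eq hS ha hc h H

theorem idemPart_eq {e : MonoidAlgebra ℚ Γ} (he : IsIrredCentralIdem e) :
    idemPart (S := S) H e = imSub (toReduced Γ S (intIdem hS he)) H := by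
  refine le_antisymm (iSup_le fun r => ?_)
    (le_iSup_of_le ⟨intIdem hS he, toRatAlg_intIdem hS he⟩ le_rfl)
  rw [show r.1 = intIdem hS he from
    toRatAlg_injective (r.2.trans (toRatAlg_intIdem hS he).symm)]
  rfl

include hS in
theorem fixedPart_eq (Δ : Subgroup Γ) :
    fixedPart (S := S) H Δ = imSub (toReduced Γ S (subIdem (ZS S) Δ)) H := by
  classical
  ext x
  constructor
  · intro hx
    refine ⟨x, ?_⟩
    change toReduced Γ S (subIdem (ZS S) Δ) • x = x
    have h1 : subIdem (ZS S) Δ =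
        single 1 (Ring.inverse (Nat.card Δ : ZS S)) * ∑ δ : Δ, single δ.1 1 := by
      rw [subIdem_def]
      ext g
      simp [MonoidAlgebra.coeff_smul]
    -- On a fixed vector the sum over `Δ` acts as `|Δ|`, a unit of `ℤ_S`, so the average fixes it.
    have h2 : (toReduced Γ S (∑ δ : Δ, single δ.1 1)) • x = toReduced Γ S (Nat.card Δ) • x := by
      rw [map_sum, Finset.sum_smul, Finset.sum_congr rfl fun δ _ => hx δ.1 δ.2, Finset.sum_const,
        Finset.card_univ, map_natCast, Nat.cast_smul_eq_nsmul, Nat.card_eq_fintype_card]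
    have h3 : (single 1 (Ring.inverse (Nat.card Δ : ZS S)) : MonoidAlgebra (ZS S) Γ) *
        (Nat.card Δ : MonoidAlgebra (ZS S) Γ) = 1 := by
      rw [MonoidAlgebra.natCast_def, MonoidAlgebra.single_mul_single, mul_one,
        Ring.inverse_mul_cancel _ (isUnit_card_subgroup hS Δ), MonoidAlgebra.one_def]
    rw [h1, map_mul, mul_smul, h2, ← mul_smul, ← map_mul, h3, map_one, one_smul]
  · rintro ⟨y, rfl⟩ γ hγ
    change _ • toReduced Γ S (subIdem (ZS S) Δ) • y = toReduced Γ S (subIdem (ZS S) Δ) • y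
    rw [← mul_smul, ← map_mul, MonoidAlgebra.of_apply, single_mul_subIdem hγ]

theorem orthogonalIdempotents_toReduced_intIdem :
    OrthogonalIdempotents fun i : Idx Γ => toReduced Γ S (intIdem hS i.1.2) where
  idem i := (isIdempotentElem_intIdem hS i.1.2).map _
  ortho i j hij := by
    change toReduced Γ S _ * toReduced Γ S _ = 0
    rw [← map_mul, show intIdem hS i.1.2 * intIdem hS j.1.2 = 0 from toRatAlg_injective (by
      rw [map_mul, toRatAlg_intIdem, toRatAlg_intIdem, map_zero]
      exact i.1.2.mul_eq_zero j.1.2 fun h => hij (Subtype.ext (Subtype.ext h))), map_zero]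

theorem sum_intIdem [Fintype (Idx Γ)] :
    ∑ i : Idx Γ, intIdem hS i.1.2 = 1 - e₁ Γ (ZS S) := by
  classical
  refine toRatAlg_injective ?_
  have : Fintype {e : MonoidAlgebra ℚ Γ // IsIrredCentralIdem e} := Fintype.ofFinite _
  let E : {e : MonoidAlgebra ℚ Γ // IsIrredCentralIdem e} := ⟨e₁ Γ ℚ, isIrredCentralIdem_e₁⟩
  rw [map_sub, map_one, toRatAlg_e₁ hS, map_sum, ← sum_irredCentralIdem_eq_one,
    ← Finset.add_sum_erase _ _ (Finset.mem_univ E), add_sub_cancel_left,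
    Finset.sum_subtype (p := fun e : {e : MonoidAlgebra ℚ Γ // IsIrredCentralIdem e} =>
      e.1 ≠ e₁ Γ ℚ) (Finset.univ.erase E) fun e => by simp [E, Subtype.ext_iff]]
  exact Finset.sum_congr rfl fun i _ => toRatAlg_intIdem hS i.1.2

theorem toReduced_sum_intIdem [Fintype (Idx Γ)] :
    ∑ i : Idx Γ, toReduced Γ S (intIdem hS i.1.2) = 1 := by
  rw [← map_sum, sum_intIdem, map_sub, map_one,
    show toReduced Γ S (e₁ Γ (ZS S)) = 0 from
      Ideal.Quotient.eq_zero_iff_mem.mpr (Ideal.mem_span_singleton_self _), sub_zero]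

theorem card_fixedPart_eq_prod [Fintype (Idx Γ)] (Δ : Subgroup Γ) :
    Nat.card (fixedPart (S := S) H Δ) =
      ∏ i : Idx Γ, Nat.card (imSub (toReduced Γ S (intIdem hS i.1.2 * subIdem (ZS S) Δ)) H) := by
  rw [fixedPart_eq hS]
  simp only [map_mul]
  exact card_imSub_eq_prod (orthogonalIdempotents_toReduced_intIdem hS)
    (fun x => by rw [toReduced_sum_intIdem, one_smul])
    fun i => (commute_intIdem hS i.1.2 _).map (toReduced Γ S)

end Reduced

/-! ### The rank as a sum of invariant dimensions, and the product formula -/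

section Rank

variable {Γ : Type*} [Group Γ] [Fintype Γ]
  {K₀ K : Type*} [Field K₀] [NumberField K₀] [Field K] [NumberField K] [Algebra K₀ K]

/-- The summand `-1` contributes minus the conjugate trace of `e₁`, which is zero by `h1`; the rest
is Frobenius reciprocity. -/
theorem pairing_chiK {V : Type*} [AddCommGroup V] [Module ℂ V]
    (ρ : Representation ℂ Γ V) (h1 : ratTrace ρ (e₁ Γ ℚ) = 0) (τ : Gal(K/K₀) ≃* Γ)
    (w : NumberField.InfinitePlace K₀ → NumberField.InfinitePlace K) :
    pairing (chiK τ w) ρ.character =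
      ∑ v, conj (ratTrace ρ (subIdem ℚ (decomp τ (w v)))) := by
  have hc : chiK τ w = (fun _ => -1) + ∑ v, induced (decomp τ (w v)) fun _ => 1 := by
    funext g
    simp [chiK]
  have h0 : pairing (fun _ => -1) ρ.character = 0 := by
    have h2 : pairing (fun _ => -1) ρ.character = -conj (ratTrace ρ (e₁ Γ ℚ)) := by
      rw [ratTrace_e₁]
      simp [pairing]
    rw [h2, h1, map_zero, neg_zero]
  rw [hc, pairing_add_left, pairing_sum_left, h0, zero_add]
  exact Finset.sum_congr rfl fun v _ => pairing_induced ρ _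

/-- Here `u_i = ∑ r_v / n`, so each place contributes an `n`-th root of `|e H|^{r_v} = |e ε_v H|^n`.
-/
theorem card_idemPart_rpow_rank {S : Set Nat.Primes}
    (hS : ∀ p ∈ S, ¬ (p : ℕ) ∣ Fintype.card Γ) (τ : Gal(K/K₀) ≃* Γ)
    (w : NumberField.InfinitePlace K₀ → NumberField.InfinitePlace K)
    {φ : Idx Γ → Γ → ℂ} {i : Idx Γ} (hφ : IsAbsIrredCharIn i.1.1 (φ i))
    (H : Type*) [AddCommGroup H] [Module (ReducedRing Γ S) H] [Finite H] :
    (Nat.card (idemPart (S := S) H i.1.1) : ℝ) ^ rank τ w φ i =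
      ∏ v, (Nat.card (imSub (toReduced Γ S
        (intIdem hS i.1.2 * subIdem (ZS S) (decomp τ (w v)))) H) : ℝ) := by
  obtain ⟨n, ρ, hρ, hφρ⟩ := hφ.1
  rw [hφρ] at hφ
  have h1 := ratHom_eq_one_of_isAbsIrredCharIn ρ hρ i.1.2 hφ
  have hV := nontrivial_of_isIrreducible ρ
  have hn0 : (Module.finrank ℂ (Fin n → ℂ) : ℝ) ≠ 0 := by
    exact_mod_cast Module.finrank_pos.ne'
  have hidem (v) : IsIdempotentElem (subIdem ℚ (decomp τ (w v))) :=
    isIdempotentElem_subIdem (isUnit_iff_ne_zero.mpr (Nat.cast_ne_zero.mpr Nat.card_pos.ne'))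
  let r := fun v => Module.finrank ℂ (LinearMap.range (ratHom ρ (subIdem ℚ (decomp τ (w v)))))
  have hr (v) : ratTrace ρ (subIdem ℚ (decomp τ (w v))) = r v :=
    ratTrace_of_isIdempotentElem ρ (hidem v)
  have hrank : rank τ w φ i = ∑ v, (r v : ℝ) * (Module.finrank ℂ (Fin n → ℂ) : ℝ)⁻¹ := by
    rw [rank, hφρ, pairing_chiK ρ (ratTrace_e₁_eq_zero ρ i.1.2 i.2 h1), hDim_eq i.1.2 ρ h1]
    simp [hr, Finset.mul_sum, mul_comm]
  have hpos : (0 : ℝ) < Nat.card (imSub (toReduced Γ S (intIdem hS i.1.2)) H) := by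
    exact_mod_cast Nat.card_pos
  rw [hrank, idemPart_eq hS H i.1.2, Real.rpow_sum_of_pos hpos]
  refine Finset.prod_congr rfl fun v _ => ?_
  have hcard := card_imSub_toReduced_pow_eq hS H (isIdempotentElem_intIdem hS i.1.2)
    (isIdempotentElem_intIdem_mul_subIdem hS i.1.2 (decomp τ (w v)))
    (sumConj_intIdem_mul_subIdem hS i.1.2 (decomp τ (w v)) ρ h1 (hr v))
  rw [Real.rpow_mul hpos.le, Real.rpow_natCast, ← Nat.cast_pow, ← hcard, Nat.cast_pow,
    ← Real.rpow_natCast, ← Real.rpow_mul (Nat.cast_nonneg _), mul_inv_cancel₀ hn0, Real.rpow_one]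

theorem weight_rank_eq {S : Set Nat.Primes}
    (hS : ∀ p ∈ S, ¬ (p : ℕ) ∣ Fintype.card Γ) (τ : Gal(K/K₀) ≃* Γ)
    (w : NumberField.InfinitePlace K₀ → NumberField.InfinitePlace K)
    {φ : Idx Γ → Γ → ℂ} (hφ : ∀ i, IsAbsIrredCharIn i.1.1 (φ i))
    (H : Type*) [AddCommGroup H] [Module (ReducedRing Γ S) H] [Finite H] :
    weight (S := S) H (rank τ w φ) =
      ∏ v, (Nat.card (fixedPart (S := S) H (decomp τ (w v))) : ℝ) := by
  have : Fintype (Idx Γ) := Fintype.ofFinite _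
  rw [weight, finprod_eq_prod_of_fintype,
    Finset.prod_congr rfl fun i _ => card_idemPart_rpow_rank hS τ w (hφ i) H, Finset.prod_comm]
  refine Finset.prod_congr rfl fun v _ => ?_
  rw [card_fixedPart_eq_prod hS, Nat.cast_prod]

end Rank

/-! ### Random modules and conjugate decomposition groups -/

section Laws

variable {Γ : Type*} [Group Γ] [Fintype Γ] {S : Set Nat.Primes}

theorem autCard_pos (G : FinMod (ReducedRing Γ S)) : 0 < autCard G := by
  have : Finite (G.carrier ≃ₗ[ReducedRing Γ S] G.carrier) :=
    Finite.of_injective (fun f => (f : G.carrier → G.carrier)) DFunLike.coe_injective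
  exact Nat.cast_pos.mpr Nat.card_pos

/-- The zero module determines `c`. Leaving `W` abstract serves both the product over all places and
the single factor when `K₀ = ℚ`. -/
theorem isCohenMartinetLaw_iff {u : Idx Γ → ℝ} {W : FinMod (ReducedRing Γ S) → ℝ}
    (hW : ∀ G, 0 < W G) (h : ∀ G, weight (S := S) G.carrier u = W G)
    (P : PMF (IsoClass (ReducedRing Γ S))) :
    IsCohenMartinetLaw u P ↔ ∃ c : ℝ, 0 < c ∧ ∀ G, prob P G = c / (W G * autCard G) := by
  have hpos (G) : 0 < W G * autCard G := mul_pos (hW G) (autCard_pos G)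
  simp only [IsCohenMartinetLaw, h]
  constructor
  · intro hP
    let G₀ : FinMod (ReducedRing Γ S) := ⟨PUnit⟩
    have h0 : 0 < prob P G₀ := by
      refine lt_of_le_of_ne ENNReal.toReal_nonneg fun h0 => ?_
      -- If the probability vanished, the left ratio would be `0 / 0 = 0`, while the right one is
      -- `1`.
      have := hP G₀ G₀
      rw [← h0, div_zero, div_self (hpos G₀).ne'] at this
      exact zero_ne_one this
    refine ⟨prob P G₀ * (W G₀ * autCard G₀), mul_pos h0 (hpos G₀), fun G => ?_⟩
    have h1 := hP G G₀
    rw [div_eq_iff h0.ne'] at h1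
    rw [h1]
    ring
  · rintro ⟨c, hc, hP⟩ G₁ G₂
    have h1 := (hpos G₁).ne'
    have h2 := (hpos G₂).ne'
    rw [hP, hP]
    field_simp

theorem fixedPart_card_pos (H : Type*) [AddCommGroup H] [Module (ReducedRing Γ S) H] [Finite H]
    (Δ : Subgroup Γ) : (0 : ℝ) < Nat.card (fixedPart (S := S) H Δ) := by
  have : Nonempty (fixedPart (S := S) H Δ) := ⟨⟨0, fun _ _ => smul_zero _⟩⟩
  exact Nat.cast_pos.mpr Nat.card_pos

/-- Multiplication by `g` injects the `Δ`-fixed points into the `Δ'`-fixed points. -/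
theorem card_fixedPart_le_of_conj (H : Type*) [AddCommGroup H] [Module (ReducedRing Γ S) H]
    [Finite H] {Δ Δ' : Subgroup Γ} (g : Γ) (h : ∀ γ ∈ Δ', g⁻¹ * γ * g ∈ Δ) :
    Nat.card (fixedPart (S := S) H Δ) ≤ Nat.card (fixedPart (S := S) H Δ') := by
  let T : Γ → H → H := fun g x => toReduced Γ S (MonoidAlgebra.of (ZS S) Γ g) • x
  have hT (a b : Γ) (x : H) : T a (T b x) = T (a * b) x := by
    simp only [T]
    rw [smul_smul, ← map_mul, ← map_mul]
  have hT1 (x : H) : T 1 x = x := by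
    simp only [T]
    rw [map_one, map_one, one_smul]
  refine Nat.card_le_card_of_injective
    (fun x => ⟨T g x.1, fun γ hγ => ?_⟩) fun x y hxy => Subtype.ext ?_
  · change T γ (T g x.1) = T g x.1
    have h1 : T (g⁻¹ * γ * g) x.1 = x.1 := x.2 _ (h γ hγ)
    conv_rhs => rw [← h1]
    rw [hT, hT]
    congr 1
    group
  · have h1 := congrArg (fun z => T g⁻¹ z.1) hxy
    simpa only [hT, inv_mul_cancel, hT1] using h1

variable {K₀ K : Type*} [Field K₀] [NumberField K₀] [Field K] [NumberField K]
    [Algebra K₀ K]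

theorem conj_mem_decomp (τ : Gal(K/K₀) ≃* Γ) (σ : Gal(K/K₀)) (w : NumberField.InfinitePlace K)
    (γ : Γ) (hγ : γ ∈ decomp τ (σ • w)) : (τ σ)⁻¹ * γ * τ σ ∈ decomp τ w := by
  obtain ⟨s, hs, rfl⟩ := hγ
  refine ⟨σ⁻¹ * s * σ, ?_, by simp⟩
  have hs' : s • σ • w = σ • w := hs
  change (σ⁻¹ * s * σ) • w = w
  rw [mul_smul, mul_smul, hs', inv_smul_smul]

theorem card_fixedPart_smul (τ : Gal(K/K₀) ≃* Γ) (σ : Gal(K/K₀)) (w : NumberField.InfinitePlace K)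
    (H : Type*) [AddCommGroup H] [Module (ReducedRing Γ S) H] [Finite H] :
    Nat.card (fixedPart (S := S) H (decomp τ (σ • w))) =
      Nat.card (fixedPart (S := S) H (decomp τ w)) := by
  refine le_antisymm (card_fixedPart_le_of_conj H (τ σ⁻¹) fun γ hγ => ?_)
    (card_fixedPart_le_of_conj H (τ σ) (conj_mem_decomp τ σ w))
  have h := conj_mem_decomp τ σ⁻¹ (σ • w) γ (by rwa [inv_smul_smul])
  exact h

theorem subsingleton_infinitePlace (h : Module.finrank ℚ K₀ = 1) :
    Subsingleton (NumberField.InfinitePlace K₀) := by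
  have : Subsingleton (K₀ →+* ℂ) := by
    rw [← Fintype.card_le_one_iff_subsingleton, NumberField.Embeddings.card, h]
  refine ⟨fun v v' => ?_⟩
  rw [← NumberField.InfinitePlace.mk_embedding v, ← NumberField.InfinitePlace.mk_embedding v',
    Subsingleton.elim v.embedding v'.embedding]

end Laws

end CohenMartinet

end

theorem mainTheorem7
    {Γ : Type*} [Group Γ] [Fintype Γ]
    {K₀ K : Type*} [Field K₀] [NumberField K₀] [Field K] [NumberField K]
    [Algebra K₀ K] [IsGalois K₀ K] (τ : Gal(K/K₀) ≃* Γ)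
    (w : NumberField.InfinitePlace K₀ → NumberField.InfinitePlace K)
    (hw : ∀ v, (w v).comap (algebraMap K₀ K) = v)
    (φ : CohenMartinet.Idx Γ → Γ → ℂ)
    (hφ : ∀ i, CohenMartinet.IsAbsIrredCharIn i.1.1 (φ i))
    (S : Set Nat.Primes) (hS : ∀ p ∈ S, ¬ (p : ℕ) ∣ Fintype.card Γ) :
    (∀ (H : Type*) [AddCommGroup H] [Module (CohenMartinet.ReducedRing Γ S) H] [Finite H],
      CohenMartinet.weight (S := S) H (CohenMartinet.rank τ w φ) =
        ∏ v : NumberField.InfinitePlace K₀,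
          (Nat.card (CohenMartinet.fixedPart (S := S) H (CohenMartinet.decomp τ (w v))) : ℝ)) ∧
    (∀ P : PMF (CohenMartinet.IsoClass (CohenMartinet.ReducedRing Γ S)),
      CohenMartinet.IsCohenMartinetLaw (CohenMartinet.rank τ w φ) P ↔
        ∃ c : ℝ, 0 < c ∧ ∀ H : CohenMartinet.FinMod (CohenMartinet.ReducedRing Γ S),
          CohenMartinet.prob P H =
            c / ((∏ v : NumberField.InfinitePlace K₀, (Nat.card (CohenMartinet.fixedPart (S := S)
              H.carrier (CohenMartinet.decomp τ (w v))) : ℝ)) * CohenMartinet.autCard H)) ∧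
    (Module.finrank ℚ K₀ = 1 → ∀ winf : NumberField.InfinitePlace K,
      ∀ P : PMF (CohenMartinet.IsoClass (CohenMartinet.ReducedRing Γ S)),
        CohenMartinet.IsCohenMartinetLaw (CohenMartinet.rank τ w φ) P ↔
          ∃ c : ℝ, 0 < c ∧ ∀ H : CohenMartinet.FinMod (CohenMartinet.ReducedRing Γ S),
            CohenMartinet.prob P H =
              c / ((Nat.card (CohenMartinet.fixedPart (S := S)
                H.carrier (CohenMartinet.decomp τ winf)) : ℝ) * CohenMartinet.autCard H)) := by
  have h1 (H : Type) [AddCommGroup H] [Module (CohenMartinet.ReducedRing Γ S) H] [Finite H] :=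
    CohenMartinet.weight_rank_eq hS τ w hφ H
  have h2 := CohenMartinet.isCohenMartinetLaw_iff
    (fun G => Finset.prod_pos fun v _ =>
      CohenMartinet.fixedPart_card_pos G.carrier (CohenMartinet.decomp τ (w v)))
    (fun G : CohenMartinet.FinMod (CohenMartinet.ReducedRing Γ S) => h1 G.carrier)
  refine ⟨fun H _ _ _ => CohenMartinet.weight_rank_eq hS τ w hφ H, h2, fun hK₀ winf P => ?_⟩
  have := CohenMartinet.subsingleton_infinitePlace hK₀
  let v₀ : NumberField.InfinitePlace K₀ := winf.comap (algebraMap K₀ K)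
  -- `winf` and the chosen `w v₀` lie above the same place of `K₀`, so the Galois group carries one
  -- to the other.
  obtain ⟨σ, hσ⟩ := NumberField.InfinitePlace.exists_smul_eq_of_comap_eq (k := K₀) (w := winf)
    (w' := w v₀) (hw v₀).symm
  refine CohenMartinet.isCohenMartinetLaw_iff
    (fun G => CohenMartinet.fixedPart_card_pos G.carrier (CohenMartinet.decomp τ winf))
    (fun G => ?_) P
  rw [h1, Fintype.prod_subsingleton _ v₀, ← hσ, CohenMartinet.card_fixedPart_smul]
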